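/- Let $G=(V,E)$ be an undirected, unweighted graph on $n$ vertices, and let each vertex $v$ have a priority $\ell(v)\in\{0,1,\dots,k\}$. Put $T_i=\{v\in V:\ell(v)\ge i\}$; the terminals are $T=T_1$. A *multi-priority spanner of $G$ with additive stretch $\beta$* is a subgraph $H$ of $G$ with edge rates $R:E(H)\to\{1,\dots,k\}$ such that for every $i\in\{1,\dots,k\}$ the subgraph $H_i$ (on the vertex set $V$) formed by the edges of rate at least $i$ is an additive $+\beta$ subset spanner over $T_i$: it connects any two vertices of $T_i$ that are connected in $G$, and $d_{H_i}(u,v)\le d_G(u,v)+\beta$ for all $u,v\in T_i$ (with $d=\infty$ for disconnected pairs). There are deterministic algorithms which, given $(G,k,\ell)$, run in time polynomial in $n+\log (k+1)$ on a random access machine and compute a multi-priority spanner $(H,R)$ of $G$ with additive stretch $2$, $4$ and $6$ respectively, with $$|E(H)| = O\bigl(n|T|^{2/3}\bigr),\qquad |E(H)|=\widetilde O\bigl(n|T|^{4/7}\bigr),\qquad |E(H)|=O\bigl(n|T|^{1/2}\bigr)$$ respectively. Moreover, each level satisfies the same bound with respect to its own terminals: for every $i\in\{1,\dots,k\}$,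 $|E(H_i)|$ is $O(n|T_i|^{2/3})$, $\widetilde O(n|T_i|^{4/7})$ and $O(n|T_i|^{1/2})$ respectively. The implied constants are absolute (independent of $G$, $n$, $k$, $\ell$ and $i$), and $\widetilde O$ hides a factor $(\log n)^{c}$ with an absolute constant $c$. -/

import Mathlib

/-! ### Random access machines, as structured programs with a step count -/

namespace RAM

/-- The registers and the memory cells of a random access machine, all holding natural numbers. -/
structure State where
  reg : ℕ → ℕ
  mem : ℕ → ℕ

/-- Structured programs of a deterministic random access machine with indirect addressing. The only
arithmetic is addition and truncated subtraction. There is no multiplication, so that `t` steps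
produce numbers with at most `t` more bits than the input and the constants of the program; hence
unit cost per step is polynomially equivalent to running time on a Turing machine. -/
inductive Program
  /-- `reg x := c` -/
  | const (x c : ℕ)
  /-- `reg x := reg y + reg z` -/
  | add (x y z : ℕ)
  /-- `reg x := reg y - reg z` (truncated at zero) -/
  | sub (x y z : ℕ)
  /-- `reg x := mem [reg y]` -/
  | load (x y : ℕ)
  /-- `mem [reg x] := reg y` -/
  | store (x y : ℕ)
  /-- `p; q` -/
  | seq (p q : Program)
  /-- `if reg x < reg y then p else q` -/
  | branch (x y : ℕ) (p q : Program)
  /-- `while reg x < reg y do p` -/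
  | loop (x y : ℕ) (p : Program)

/-- `Exec p s s' t`: the program `p`, started in the state `s`, halts in the state `s'` after exactly
`t` steps. Every assignment, memory access and test is one step. -/
inductive Exec : Program → State → State → ℕ → Prop
  | const (x c : ℕ) (s : State) :
      Exec (.const x c) s ⟨Function.update s.reg x c, s.mem⟩ 1
  | add (x y z : ℕ) (s : State) :
      Exec (.add x y z) s ⟨Function.update s.reg x (s.reg y + s.reg z), s.mem⟩ 1
  | sub (x y z : ℕ) (s : State) :
      Exec (.sub x y z) s ⟨Function.update s.reg x (s.reg y - s.reg z), s.mem⟩ 1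
  | load (x y : ℕ) (s : State) :
      Exec (.load x y) s ⟨Function.update s.reg x (s.mem (s.reg y)), s.mem⟩ 1
  | store (x y : ℕ) (s : State) :
      Exec (.store x y) s ⟨s.reg, Function.update s.mem (s.reg x) (s.reg y)⟩ 1
  | seq {p q : Program} {s₁ s₂ s₃ : State} {t₁ t₂ : ℕ} :
      Exec p s₁ s₂ t₁ → Exec q s₂ s₃ t₂ → Exec (.seq p q) s₁ s₃ (t₁ + t₂)
  | branch_true {x y : ℕ} {p q : Program} {s s' : State} {t : ℕ} :
      s.reg x < s.reg y → Exec p s s' t → Exec (.branch x y p q) s s' (t + 1)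
  | branch_false {x y : ℕ} {p q : Program} {s s' : State} {t : ℕ} :
      ¬ s.reg x < s.reg y → Exec q s s' t → Exec (.branch x y p q) s s' (t + 1)
  | loop_done {x y : ℕ} {p : Program} {s : State} :
      ¬ s.reg x < s.reg y → Exec (.loop x y p) s s 1
  | loop_step {x y : ℕ} {p : Program} {s₁ s₂ s₃ : State} {t₁ t₂ : ℕ} :
      s₁.reg x < s₁.reg y → Exec p s₁ s₂ t₁ → Exec (.loop x y p) s₂ s₃ t₂ →
      Exec (.loop x y p) s₁ s₃ (t₁ + t₂ + 1)

end RAM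

/-! ### Multi-priority spanners -/

namespace MultiPriority

/-- `H` is a subset spanner of the unweighted graph `G` over the terminals `T` with additive
stretch `β`. Distances take values in `ℕ∞`. -/
structure IsAdditiveSubsetSpanner {V : Type*} (β : ℕ) (G : SimpleGraph V) (T : Finset V)
    (H : SimpleGraph V) : Prop where
  le : H ≤ G
  reachable : ∀ u ∈ T, ∀ v ∈ T, G.Reachable u v → H.Reachable u v
  edist_le : ∀ u ∈ T, ∀ v ∈ T, H.edist u v ≤ G.edist u v + β

/-- An unweighted undirected graph on `n` vertices, with priorities in `{0, 1, ..., k}`. -/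
structure Instance where
  n : ℕ
  k : ℕ
  graph : SimpleGraph (Fin n)
  priority : Fin n → Fin (k + 1)

/-- `T_i`, the vertices of priority at least `i`. The set of all terminals is `T_1`. -/
def Instance.terminals (I : Instance) (i : ℕ) : Finset (Fin I.n) :=
  Finset.univ.filter fun v => i ≤ (I.priority v : ℕ)

/-- A subgraph of `G` whose edges have rates in `{1, ..., k}`. The values of `rate` outside the
edge set play no role. -/
structure RatedSubgraph {V : Type*} (G : SimpleGraph V) (k : ℕ) where
  graph : SimpleGraph V
  le : graph ≤ G
  rate : Sym2 V → ℕ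
  rate_mem : ∀ e ∈ graph.edgeSet, rate e ∈ Set.Icc 1 k

/-- The subgraph formed by the edges of rate at least `i`. -/
def RatedSubgraph.level {V : Type*} {G : SimpleGraph V} {k : ℕ} (H : RatedSubgraph G k) (i : ℕ) :
    SimpleGraph V where
  Adj u v := H.graph.Adj u v ∧ i ≤ H.rate s(u, v)
  symm := ⟨fun u v h => ⟨h.1.symm, by rw [Sym2.eq_swap]; exact h.2⟩⟩
  loopless := ⟨fun v h => H.graph.loopless.irrefl v h.1⟩

/-- `H` is a multi-priority (`k`-priority) spanner with additive stretch `β`. -/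
def Instance.IsAdditiveSpanner (I : Instance) (β : ℕ) (H : RatedSubgraph I.graph I.k) : Prop :=
  ∀ i ∈ Set.Icc 1 I.k, IsAdditiveSubsetSpanner β I.graph (I.terminals i) (H.level i)

/-! ### Algorithms on instances -/

/-- The order of magnitude of the input length: number of vertices plus number of bits of `k`. -/
def Instance.size (I : Instance) : ℕ := I.n + Nat.size I.k

open Classical in
/-- The initial state: `n` and `k` in registers `0` and `1`, the priority of `v` in cell `v`, the
adjacency matrix row by row from cell `n` on (the entry at `u, v` is in cell `n + (n * u + v)`),
and zero everywhere else. -/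
noncomputable def Instance.encode (I : Instance) : RAM.State where
  reg x := if x = 0 then I.n else if x = 1 then I.k else 0
  mem a :=
    if h : a < I.n then (I.priority ⟨a, h⟩ : ℕ)
    else if h : a - I.n < I.n * I.n then
      (if I.graph.Adj (Fin.divNat ⟨a - I.n, h⟩) (Fin.modNat ⟨a - I.n, h⟩) then 1 else 0)
    else 0

open Classical in
/-- The final state `s` holds `H`: cell `n * u + v` contains the rate of `uv` if this is an edge
of `H`, and zero otherwise. -/
def Instance.IsOutput (I : Instance) (s : RAM.State) (H : RatedSubgraph I.graph I.k) : Prop :=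
  ∀ u v : Fin I.n,
    s.mem (I.n * (u : ℕ) + (v : ℕ)) = if H.graph.Adj u v then H.rate s(u, v) else 0

/-- There is a polynomial-time algorithm which, for every instance `I`, computes a rated subgraph
`H` with the property `Good I H`. -/
def PolyTimeComputable (Good : (I : Instance) → RatedSubgraph I.graph I.k → Prop) : Prop :=
  ∃ (p : RAM.Program) (P : Polynomial ℕ), ∀ I : Instance,
    ∃ (s : RAM.State) (t : ℕ) (H : RatedSubgraph I.graph I.k),
      RAM.Exec p I.encode s t ∧ t ≤ P.eval I.size ∧ I.IsOutput s H ∧ Good I H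

/-- Every level of `H`, and in particular `H` itself, is sparse: `H` has at most
`f n |T|` edges, and at most `f n |T_i|` of them have rate at least `i`. -/
def Instance.SizeBound (I : Instance) (f : ℕ → ℕ → ℝ) (H : RatedSubgraph I.graph I.k) : Prop :=
  (H.graph.edgeSet.ncard : ℝ) ≤ f I.n (I.terminals 1).card ∧
  ∀ i ∈ Set.Icc 1 I.k, ((H.level i).edgeSet.ncard : ℝ) ≤ f I.n (I.terminals i).card

end MultiPriority

/-! One algorithm proves all three claims: it reaches stretch 2 with at most 74 * n * |T_i|^(1/2)
edges at every level, and 1/2 ≤ 4/7 ≤ 2/3.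

For one terminal set S with |S| ≤ 4h², let every vertex keep all its edges or at least h of them;
this costs at most nh edges. Then, as long as some terminals u, v satisfy d_H(u,v) > d_G(u,v) + 2,
add a shortest path of G between them. Each missing edge of that path starts at a vertex with at
least h neighbours in H, and a vertex w is adjacent to at most three vertices of a shortest path. So
m new edges yield at least mh/3 such neighbours w. For each of them the enlarged graph realises
d_G(u,w) and d_G(v,w) up to +2, and one of the two distances strictly drops, since otherwise the
detour through w would already give d_H(u,v) ≤ d_G(u,v) + 2. A pair (s,w) with s in S can profit at
most three times, so at most 9n|S|/h ≤ 36nh edges are added (`deficit_addWalk_lt`,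
`addWalk_potential_le`, `ncard_le_of_potential_le`).

For the priorities, round j takes h = 2^j and treats the levels with 4^j ≤ |T_i| < 4^(j+1). It
extends all edges chosen so far to a spanner over the largest of these T_i, and gives the new edges
the largest level r with |T_r| ≥ 4^j as their rate. As j grows, r can only fall, so older edges
belong to every level treated in the round. Level i receives edges only from rounds with 4^j ≤
|T_i|, and the sum of 37 * n * 2^j over them is at most 74 * n * |T_i|^(1/2)
(`Instance.RoundInvariant.succ`, `roundWeight_sq_le`).

The algorithm is written in a language whose loops all make n passes, so that polynomial time is
read off the syntax (`exec_compile`). Correctness is proved on the denotation `run` with loop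
invariants (`run_loop`), up to `round_spec` and `spanner_spec`. -/

namespace RAM

/-! ### A language of bounded loops: semantics, compilation and running time. -/

/-- Programs whose only loops run over `0, ..., n - 1`, where `n` is the value of register `0`. -/
inductive Cmd
  | const (x c : ℕ)
  | add (x y z : ℕ)
  | load (x y : ℕ)
  | store (x y : ℕ)
  | seq (p q : Cmd)
  | ite (x y : ℕ) (p q : Cmd)
  | loop (i : ℕ) (p : Cmd)

namespace Cmd

/-- Sequential composition. -/
infixr:60 " ;; " => Cmd.seq

/-- The assignment `reg x := v`. -/
def _root_.RAM.State.set (s : State) (x v : ℕ) : State := ⟨Function.update s.reg x v, s.mem⟩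

/-- The denotation of a command. -/
def run (n : ℕ) : Cmd → State → State
  | const x c, s => s.set x c
  | add x y z, s => s.set x (s.reg y + s.reg z)
  | load x y, s => s.set x (s.mem (s.reg y))
  | store x y, s => ⟨s.reg, Function.update s.mem (s.reg x) (s.reg y)⟩
  | seq p q, s => run n q (run n p s)
  | ite x y p q, s => if s.reg x < s.reg y then run n p s else run n q s
  | loop i p, s => Nat.rec (s.set i 0) (fun j s' => (run n p s').set i (j + 1)) n

/-- Compilation; register `2` is supposed to hold `1`. -/
def compile : Cmd → Program
  | const x c => .const x c
  | add x y z => .add x y z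
  | load x y => .load x y
  | store x y => .store x y
  | seq p q => .seq (compile p) (compile q)
  | ite x y p q => .branch x y (compile p) (compile q)
  | loop i p => .seq (.const i 0) (.loop i 0 (.seq (compile p) (.add i i 2)))

/-- `c.modifies x`: the command `c` may write to register `x`. -/
def modifies (x : ℕ) : Cmd → Bool
  | const y _ | add y _ _ | load y _ => x == y
  | store _ _ => false
  | seq p q | ite _ _ p q => modifies x p || modifies x q
  | loop i p => x == i || modifies x p

/-- No command writes to its loop variables, to register `0` or to register `2`. -/
def wf : Cmd → Bool
  | const x _ | add x _ _ | load x _ => x != 0 && x != 2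
  | store _ _ => true
  | seq p q | ite _ _ p q => wf p && wf q
  | loop i p => i != 0 && i != 2 && !modifies i p && wf p

/-- A bound on the running time, as a polynomial in `n`. -/
noncomputable def cost : Cmd → Polynomial ℕ
  | const _ _ | add _ _ _ | load _ _ | store _ _ => 1
  | seq p q => cost p + cost q
  | ite _ _ p q => cost p + cost q + 1
  | loop _ p => Polynomial.X * (cost p + 2) + 2

@[simp] theorem set_mem (s : State) (x v : ℕ) : (s.set x v).mem = s.mem := rfl

theorem set_reg (s : State) (x v y : ℕ) : (s.set x v).reg y = if y = x then v else s.reg y := by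
  simp [State.set, Function.update_apply]

@[simp] theorem set_reg_self (s : State) (x v : ℕ) : (s.set x v).reg x = v := by
  simp [set_reg]

theorem run_loop_induction {n i : ℕ} {p : Cmd} {s : State} (P : ℕ → State → Prop)
    (zero : P 0 (s.set i 0))
    (succ : ∀ j s', j < n → P j s' → P (j + 1) ((run n p s').set i (j + 1))) :
    P n (run n (loop i p) s) := by
  have key : ∀ m ≤ n,
      P m (Nat.rec (s.set i 0) (fun j s' => (run n p s').set i (j + 1)) m) := by
    intro m
    induction m with
    | zero => intro _; exact zero
    | succ m ih => intro hm; exact succ m _ hm (ih (by omega))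
  exact key n le_rfl

theorem run_reg_of_not_modifies (n : ℕ) {x : ℕ} (c : Cmd) (h : modifies x c = false)
    (s : State) : (run n c s).reg x = s.reg x := by
  induction c generalizing s with
  | const y c | add y _ _ | load y _ =>
    simp only [modifies, beq_eq_false_iff_ne] at h
    simp [run, set_reg, h]
  | store => rfl
  | seq p q ihp ihq =>
    simp only [modifies, Bool.or_eq_false_iff] at h
    simp [run, ihq h.2, ihp h.1]
  | ite y z p q ihp ihq =>
    simp only [modifies, Bool.or_eq_false_iff] at h
    simp only [run]; split_ifs
    exacts [ihp h.1 s, ihq h.2 s]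
  | loop i p ih =>
    simp only [modifies, Bool.or_eq_false_iff, beq_eq_false_iff_ne] at h
    refine run_loop_induction (fun _ s' => s'.reg x = s.reg x) ?_ ?_
    · simp [set_reg, h.1]
    · intro j s' _ hs
      simp [set_reg, h.1, ih h.2, hs]

/-- Induction over the iterations of a loop, with the values of the loop variable and of the
registers that are not modified. -/
theorem run_loop {n i : ℕ} {p : Cmd} {s : State}
    (P : ℕ → State → Prop) (zero : P 0 (s.set i 0))
    (succ : ∀ j s', j < n → s'.reg i = j →
      (∀ x, modifies x (loop i p) = false → s'.reg x = s.reg x) → P j s' →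
      P (j + 1) ((run n p s').set i (j + 1))) :
    P n (run n (loop i p) s) := by
  refine (run_loop_induction (fun j s' => s'.reg i = j ∧
    (∀ x, modifies x (loop i p) = false → s'.reg x = s.reg x) ∧ P j s') ?_ ?_).2.2
  · refine ⟨by simp, fun x hx => ?_, zero⟩
    simp only [modifies, Bool.or_eq_false_iff, beq_eq_false_iff_ne] at hx
    simp [set_reg, hx.1]
  · rintro j s' hj ⟨h1, h2, h3⟩
    refine ⟨by simp, fun x hx => ?_, succ j s' hj h1 h2 h3⟩
    have hx' := hx
    simp only [modifies, Bool.or_eq_false_iff, beq_eq_false_iff_ne] at hx'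
    rw [set_reg, if_neg hx'.1, run_reg_of_not_modifies n p hx'.2, h2 x hx]

theorem modifies_zero_and_two (c : Cmd) (h : wf c = true) :
    modifies 0 c = false ∧ modifies 2 c = false := by
  induction c with
  | const y c | add y _ _ | load y _ =>
    simp only [wf, Bool.and_eq_true, bne_iff_ne] at h
    simp [modifies, h.1.symm, h.2.symm]
  | store => simp [modifies]
  | seq p q ihp ihq | ite _ _ p q ihp ihq =>
    simp only [wf, Bool.and_eq_true] at h
    simp [modifies, ihp h.1, ihq h.2]
  | loop i p ih =>
    simp only [wf, Bool.and_eq_true, bne_iff_ne] at h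
    simp [modifies, ih h.2, h.1.1.1.symm, h.1.1.2.symm]

/-- Well-formedness protects the loop variable, the bound in register 0 and the increment in
register 2, so the compiled while loop makes exactly n passes. -/
theorem exec_compile (n : ℕ) (c : Cmd) (h : wf c = true) (s : State) (h0 : s.reg 0 = n)
    (h2 : s.reg 2 = 1) : ∃ t ≤ (cost c).eval n, Exec (compile c) s (run n c s) t := by
  induction c generalizing s with
  | const y c => exact ⟨1, by simp [cost], .const ..⟩
  | add => exact ⟨1, by simp [cost], .add ..⟩
  | load => exact ⟨1, by simp [cost], .load ..⟩
  | store => exact ⟨1, by simp [cost], .store ..⟩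
  | seq p q ihp ihq =>
    simp only [wf, Bool.and_eq_true] at h
    obtain ⟨t1, ht1, e1⟩ := ihp h.1 s h0 h2
    have hm := modifies_zero_and_two p h.1
    obtain ⟨t2, ht2, e2⟩ := ihq h.2 (run n p s)
      (by rw [run_reg_of_not_modifies n p hm.1, h0])
      (by rw [run_reg_of_not_modifies n p hm.2, h2])
    exact ⟨t1 + t2, by simp only [cost, Polynomial.eval_add]; omega, .seq e1 e2⟩
  | ite x y p q ihp ihq =>
    simp only [wf, Bool.and_eq_true] at h
    simp only [run, cost, Polynomial.eval_add, Polynomial.eval_one]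
    split_ifs with hxy
    · obtain ⟨t, ht, e⟩ := ihp h.1 s h0 h2
      exact ⟨t + 1, by omega, .branch_true hxy e⟩
    · obtain ⟨t, ht, e⟩ := ihq h.2 s h0 h2
      exact ⟨t + 1, by omega, .branch_false hxy e⟩
  | loop i p ih =>
    simp only [wf, Bool.and_eq_true, bne_iff_ne, Bool.not_eq_true'] at h
    obtain ⟨⟨⟨hi0, hi2⟩, hi⟩, hp⟩ := h
    have hm := modifies_zero_and_two p hp
    set f : ℕ → State := fun m =>
      Nat.rec (s.set i 0) (fun j s' => (run n p s').set i (j + 1)) m with hf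
    have hreg : ∀ m, (f m).reg 0 = n ∧ (f m).reg 2 = 1 ∧ (f m).reg i = m := by
      intro m
      induction m with
      | zero => simp [hf, set_reg, hi0.symm, hi2.symm, h0, h2]
      | succ m ihm =>
        simp only [hf, set_reg, hi0.symm, hi2.symm, if_false, if_true, and_true]
        rw [run_reg_of_not_modifies n p hm.1, run_reg_of_not_modifies n p hm.2]
        exact ⟨ihm.1, ihm.2.1⟩
    -- Induction on the number d of remaining passes; each costs the body, one test and one
    -- increment.
    have hloop : ∀ d m, m + d = n → ∃ t ≤ d * ((cost p).eval n + 2) + 1,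
        Exec (.loop i 0 (.seq (compile p) (.add i i 2))) (f m) (f n) t := by
      intro d
      induction d with
      | zero =>
        rintro m rfl
        exact ⟨1, by omega, .loop_done (by simp [hreg])⟩
      | succ d ihd =>
        intro m hmd
        obtain ⟨t, ht, e⟩ := ih hp (f m) (hreg m).1 (hreg m).2.1
        obtain ⟨t', ht', e'⟩ := ihd (m + 1) (by omega)
        have hadd := Exec.add i i 2 (run n p (f m))
        have heq : (⟨Function.update (run n p (f m)).reg i
            ((run n p (f m)).reg i + (run n p (f m)).reg 2), (run n p (f m)).mem⟩ : State)
            = f (m + 1) := by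
          rw [run_reg_of_not_modifies n p hi, run_reg_of_not_modifies n p hm.2, (hreg m).2.1,
            (hreg m).2.2]
          rfl
        rw [heq] at hadd
        refine ⟨t + 1 + t' + 1, ?_, .loop_step (by rw [(hreg m).1, (hreg m).2.2]; omega)
          (.seq e hadd) e'⟩
        rw [Nat.add_mul]
        omega
    obtain ⟨t, ht, e⟩ := hloop n 0 (by omega)
    refine ⟨1 + t, ?_, .seq (.const i 0 s) e⟩
    simp only [cost, Polynomial.eval_add, Polynomial.eval_mul, Polynomial.eval_X,
      Polynomial.eval_ofNat]
    omega

/-! ### Memory as a matrix with rows of length n. -/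

/-- The entry in row `r` and column `c`, the memory being cut into rows of length `n`. -/
def view (n : ℕ) (s : State) (r : ℕ) (c : Fin n) : ℕ := s.mem (n * r + c)

/-- A command without relevant effect. -/
def skip : Cmd := const 19 0

/-- `reg x := row (reg r), column (reg c)` -/
def get (x r c : ℕ) : Cmd := const 4 0 ;; loop 3 (add 4 4 r) ;; add 4 4 c ;; load x 4

/-- `row (reg r), column (reg c) := reg y` -/
def put (r c y : ℕ) : Cmd := const 4 0 ;; loop 3 (add 4 4 r) ;; add 4 4 c ;; store 4 y

/-- In the absence of multiplication, n * r is built by n additions. Registers 3 and 4 are scratch,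
hence the side conditions on operands throughout. -/
theorem run_address (n : ℕ) {r c : ℕ} (hr : 5 ≤ r ∨ r < 3) (hc : 5 ≤ c ∨ c < 3) (s : State) :
    run n (const 4 0 ;; loop 3 (add 4 4 r) ;; add 4 4 c) s =
      (s.set 3 n).set 4 (n * s.reg r + s.reg c) := by
  have h := run_loop_induction (n := n) (i := 3) (p := add 4 4 r) (s := s.set 4 0)
    (fun j s' => s' = (s.set 3 j).set 4 (j * s.reg r)) ?_ ?_
  · simp only [run] at h ⊢
    rw [h]
    simp only [State.set, State.mk.injEq, and_true]
    funext x
    simp only [Function.update_apply]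
    split_ifs <;> first | rfl | omega
  · simp only [State.set, State.mk.injEq, and_true]
    funext x
    simp only [Function.update_apply]
    split_ifs <;> first | rfl | omega
  · rintro j s' _ rfl
    simp only [State.set, State.mk.injEq, and_true, run]
    funext x
    simp only [Function.update_apply]
    split_ifs <;> first | rfl | omega | (subst_vars; ring)

theorem run_get (n : ℕ) {x r c : ℕ} (hr : 5 ≤ r ∨ r < 3) (hc : 5 ≤ c ∨ c < 3) (s : State) :
    run n (get x r c) s =
      ((s.set 3 n).set 4 (n * s.reg r + s.reg c)).set x (s.mem (n * s.reg r + s.reg c)) := by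
  have := run_address n hr hc s
  simp only [run, get] at this ⊢
  rw [this]
  simp

theorem run_put (n : ℕ) {r c y : ℕ} (hr : 5 ≤ r ∨ r < 3) (hc : 5 ≤ c ∨ c < 3)
    (hy : 5 ≤ y ∨ y < 3) (s : State) :
    run n (put r c y) s =
      ⟨((s.set 3 n).set 4 (n * s.reg r + s.reg c)).reg,
        Function.update s.mem (n * s.reg r + s.reg c) (s.reg y)⟩ := by
  have := run_address n hr hc s
  simp only [run, put] at this ⊢
  rw [this]
  simp [set_reg, show y ≠ 3 by omega, show y ≠ 4 by omega]

theorem address_inj {n r r' c c' : ℕ} (hc : c < n) (hc' : c' < n) :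
    n * r + c = n * r' + c' ↔ r = r' ∧ c = c' := by
  constructor
  · intro h
    have h1 : (n * r + c) / n = (n * r' + c') / n := by rw [h]
    have hn : 0 < n := by omega
    rw [Nat.mul_add_div hn, Nat.mul_add_div hn, Nat.div_eq_of_lt hc, Nat.div_eq_of_lt hc'] at h1
    have : r = r' := by omega
    subst this
    exact ⟨rfl, by omega⟩
  · rintro ⟨rfl, rfl⟩; rfl

theorem view_update {n : ℕ} (reg mem : ℕ → ℕ) (r0 v r : ℕ) (c0 c : Fin n) :
    view n ⟨reg, Function.update mem (n * r0 + c0) v⟩ r c =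
      if r = r0 ∧ c = c0 then v else mem (n * r + c) := by
  simp only [view, Function.update_apply, address_inj c.2 c0.2, Fin.ext_iff]

end Cmd

end RAM

/-! ### The potential argument for stretch 2. -/

namespace SimpleGraph

variable {V : Type*}

open Classical in
/-- The number of `j < 3` such that `H` does not preserve the distance of `s` and `w` in `G` up to
an additive error `j`. -/
noncomputable def deficit (G H : SimpleGraph V) (s w : V) : ℕ :=
  ((Finset.range 3).filter fun j : ℕ => G.edist s w + j < H.edist s w).card

theorem deficit_le_three (G H : SimpleGraph V) (s w : V) : deficit G H s w ≤ 3 :=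
  (Finset.card_filter_le _ _).trans (by simp)

theorem deficit_anti {G H H' : SimpleGraph V} (h : H ≤ H') (s w : V) :
    deficit G H' s w ≤ deficit G H s w := by
  classical
  refine Finset.card_le_card fun j hj => ?_
  simp only [Finset.mem_filter] at hj ⊢
  exact ⟨hj.1, hj.2.trans_le (edist_anti h)⟩

/-- The error of `H'` itself, a number in {0, 1, 2}, is counted for `H` but no longer for `H'`. -/
theorem deficit_lt {G H H' : SimpleGraph V} (h : H ≤ H') (hG : H' ≤ G) {s w : V}
    (h2 : H'.edist s w ≤ G.edist s w + 2) (hlt : H'.edist s w < H.edist s w) :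
    deficit G H' s w < deficit G H s w := by
  classical
  have hfin : H'.edist s w ≠ ⊤ := (hlt.trans_le le_top).ne
  have hle : G.edist s w ≤ H'.edist s w := edist_anti hG
  obtain ⟨a, ha⟩ := ENat.ne_top_iff_exists.1 hfin
  obtain ⟨b, hb⟩ := ENat.ne_top_iff_exists.1 (hle.trans_lt (lt_top_iff_ne_top.2 hfin)).ne
  rw [← ha, ← hb] at hle h2
  have hle' : b ≤ a := by exact_mod_cast hle
  have h2' : a ≤ b + 2 := by exact_mod_cast h2
  refine Finset.card_lt_card ⟨fun j hj => ?_, fun hsub => ?_⟩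
  · simp only [Finset.mem_filter] at hj ⊢
    exact ⟨hj.1, hj.2.trans_le (edist_anti h)⟩
  · have hmem : a - b ∈ (Finset.range 3).filter
        fun j : ℕ => G.edist s w + j < H.edist s w := by
      simp only [Finset.mem_filter, Finset.mem_range]
      refine ⟨by omega, ?_⟩
      rw [← hb, ← Nat.cast_add, Nat.add_sub_cancel' hle', ha]
      exact hlt
    have := (Finset.mem_filter.1 (hsub hmem)).2
    rw [← hb, ← ha, ← Nat.cast_add, Nat.add_sub_cancel' hle'] at this
    exact this.false

/-- The potential that decreases whenever a shortest path is added. -/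
noncomputable def totalDeficit [Fintype V] (G H : SimpleGraph V) (S : Finset V) : ℕ :=
  ∑ w, ∑ s ∈ S, deficit G H s w

theorem totalDeficit_le [Fintype V] (G H : SimpleGraph V) (S : Finset V) :
    totalDeficit G H S ≤ Fintype.card V * (S.card * 3) := by
  refine (Finset.sum_le_card_nsmul _ _ (S.card * 3) fun w _ => ?_).trans (by simp)
  exact (Finset.sum_le_card_nsmul _ _ 3 fun s _ => deficit_le_three ..).trans (by simp)

/-- Add the edges of a walk to a graph. -/
abbrev addWalk (H : SimpleGraph V) {G : SimpleGraph V} {u v : V} (p : G.Walk u v) :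
    SimpleGraph V := H ⊔ fromEdgeSet {e | e ∈ p.edges}

theorem addWalk_le {G H : SimpleGraph V} (h : H ≤ G) {u v : V} (p : G.Walk u v) :
    H.addWalk p ≤ G := by
  refine sup_le h fun x y hxy => ?_
  exact p.adj_of_mem_edges (by simpa using (fromEdgeSet_adj _).1 hxy |>.1)

theorem mem_edgeSet_addWalk {G H : SimpleGraph V} {u v : V} {p : G.Walk u v} {e : Sym2 V}
    (he : e ∈ p.edges) : e ∈ (H.addWalk p).edgeSet := by
  have hG := p.edges_subset_edgeSet he
  induction e with
  | h x y =>
    rw [mem_edgeSet, sup_adj, fromEdgeSet_adj]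
    exact Or.inr ⟨he, G.ne_of_adj hG⟩

theorem edist_addWalk_le {G : SimpleGraph V} (H : SimpleGraph V) {u v : V} (p : G.Walk u v)
    {i : ℕ} (hi : i ≤ p.length) :
    (H.addWalk p).edist u (p.getVert i) ≤ i ∧
      (H.addWalk p).edist (p.getVert i) v ≤ (p.length - i : ℕ) := by
  constructor
  · have := edist_le ((p.take i).transfer (H.addWalk p) fun e he =>
      mem_edgeSet_addWalk ((p.isSubwalk_take i).edges_isInfix.subset he))
    simpa [hi] using this
  · have := edist_le ((p.drop i).transfer (H.addWalk p) fun e he =>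
      mem_edgeSet_addWalk ((p.isSubwalk_drop i).edges_isInfix.subset he))
    simpa [hi] using this

/-- Both parts of a shortest path are shortest: by the triangle inequality, a shortcut on either
side would shorten the whole. -/
theorem le_edist_getVert {G : SimpleGraph V} {u v : V} {p : G.Walk u v}
    (hp : (p.length : ℕ∞) = G.edist u v) {i : ℕ} (hi : i ≤ p.length) :
    (i : ℕ∞) ≤ G.edist u (p.getVert i) ∧ ((p.length - i : ℕ) : ℕ∞) ≤ G.edist (p.getVert i) v := by
  have h1 : G.edist u (p.getVert i) ≤ i := by
    simpa [hi] using edist_le (p.take i)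
  have h2 : G.edist (p.getVert i) v ≤ (p.length - i : ℕ) := by
    simpa [hi] using edist_le (p.drop i)
  have h3 := G.edist_triangle (u := u) (v := p.getVert i) (w := v)
  rw [← hp] at h3
  obtain ⟨a, ha⟩ := ENat.ne_top_iff_exists.1 (h1.trans_lt (ENat.natCast_lt_top i)).ne
  obtain ⟨b, hb⟩ := ENat.ne_top_iff_exists.1 (h2.trans_lt (ENat.natCast_lt_top _)).ne
  rw [← ha] at h1 h3 ⊢
  rw [← hb] at h2 h3 ⊢
  norm_cast at *
  omega

/-- A common neighbour puts the two vertices at distance at most 2 in `G`, and a shortest path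
cannot be shortcut. -/
theorem le_add_two_of_adj_getVert {G : SimpleGraph V} {u v w : V} {p : G.Walk u v}
    (hp : (p.length : ℕ∞) = G.edist u v) {i j : ℕ} (hj : j ≤ p.length)
    (h1 : G.Adj (p.getVert i) w) (h2 : G.Adj (p.getVert j) w) : j ≤ i + 2 := by
  by_contra! hlt
  have h3 := (le_edist_getVert hp hj).1
  have h4 : G.edist u (p.getVert i) ≤ i := by
    simpa [show i ≤ p.length by omega] using edist_le (p.take i)
  have h5 := (G.edist_triangle (u := u) (v := p.getVert i) (w := w)).trans
    (add_le_add h4 (edist_eq_one_iff_adj.2 h1).le)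
  have h6 := h3.trans ((G.edist_triangle (v := w)).trans
    (add_le_add h5 (edist_eq_one_iff_adj.2 h2.symm).le))
  norm_cast at h6
  omega

/-- The steps at which a walk leaves `H`. -/
noncomputable def missing (H : SimpleGraph V) {G : SimpleGraph V} {u v : V} (p : G.Walk u v) :
    Finset ℕ := by
  classical exact (Finset.range p.length).filter fun i => ¬ H.Adj (p.getVert i) (p.getVert (i + 1))

theorem mem_missing {G H : SimpleGraph V} {u v : V} {p : G.Walk u v} {i : ℕ} :
    i ∈ H.missing p ↔ i < p.length ∧ ¬ H.Adj (p.getVert i) (p.getVert (i + 1)) := by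
  simp [missing]

theorem ncard_edgeSet_addWalk_le [Finite V] {G : SimpleGraph V} (H : SimpleGraph V) {u v : V}
    (p : G.Walk u v) :
    (H.addWalk p).edgeSet.ncard ≤ H.edgeSet.ncard + (H.missing p).card := by
  classical
  have hsub : (H.addWalk p).edgeSet ⊆ H.edgeSet ∪
      ((H.missing p).image fun i => s(p.getVert i, p.getVert (i + 1)) : Finset (Sym2 V)) := by
    intro e he
    by_cases heH : e ∈ H.edgeSet
    · exact Or.inl heH
    refine Or.inr ?_
    have hep : e ∈ p.edges := by
      induction e with
      | h x y =>
        rw [mem_edgeSet, sup_adj, fromEdgeSet_adj] at he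
        exact (he.resolve_left heH).1
    induction e with
    | h x y =>
      obtain ⟨i, hi, he'⟩ := (p.mk_mem_edges_iff_exists).1 hep
      simp only [Finset.coe_image, Set.mem_image, Finset.mem_coe, mem_missing]
      refine ⟨i, ⟨hi, fun hadj => heH ?_⟩, he'⟩
      rw [← he']
      exact hadj
  refine (Set.ncard_le_ncard hsub (Set.toFinite _)).trans ((Set.ncard_union_le _ _).trans ?_)
  rw [Set.ncard_coe_finset]
  exact Nat.add_le_add_left Finset.card_image_le _

/-- Double counting of adjacencies between the missing steps and `W`. A vertex where a step is
missing has lost an edge, hence has at least `h` neighbours; the steps adjacent to one `w` lie in an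
interval of three indices. -/
theorem card_missing_mul_le [Fintype V] {G H : SimpleGraph V} (hHG : H ≤ G) {h : ℕ}
    (hinit : ∀ x, (∀ y, G.Adj x y → H.Adj x y) ∨ h ≤ {y | H.Adj x y}.ncard) {u v : V}
    {p : G.Walk u v} (hp : (p.length : ℕ∞) = G.edist u v) (W : Finset V)
    (hW : ∀ w, w ∈ W ↔ ∃ i ∈ H.missing p, H.Adj (p.getVert i) w) :
    (H.missing p).card * h ≤ W.card * 3 := by
  classical
  refine Finset.card_mul_le_card_mul (fun i w => H.Adj (p.getVert i) w) (fun i hi => ?_)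
    fun w _ => ?_
  · have hm := mem_missing.1 hi
    refine ((hinit (p.getVert i)).resolve_left fun hall =>
      hm.2 (hall _ (p.adj_getVert_succ hm.1))).trans ?_
    rw [← Set.ncard_coe_finset]
    refine Set.ncard_le_ncard (fun w hw => ?_) (Set.toFinite _)
    simp only [Finset.bipartiteAbove, Finset.coe_filter, Set.mem_ofPred_eq]
    exact ⟨(hW w).2 ⟨i, hi, hw⟩, hw⟩
  · rcases ((H.missing p).bipartiteBelow (fun i w => H.Adj (p.getVert i) w) w).eq_empty_or_nonempty
      with he | hne
    · simp [he]
    · have hmin := Finset.min'_mem _ hne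
      set i₀ := Finset.min' _ hne
      refine (Finset.card_le_card (t := Finset.Icc i₀ (i₀ + 2)) fun j hj => ?_).trans
        (by simp; omega)
      have hj0 := Finset.min'_le _ j hj
      simp only [Finset.bipartiteBelow, Finset.mem_filter, mem_missing] at hj hmin
      exact Finset.mem_Icc.2 ⟨hj0, le_add_two_of_adj_getVert hp hj.1.1.le (hHG hmin.2) (hHG hj.2)⟩

/-- Through the new path, `w` comes within +2 of its distance from both ends. If neither distance
dropped, the old graph would join `u` to `v` through `w` in at most `p.length + 2` steps, against
`hviol`. -/
theorem deficit_addWalk_lt {G H : SimpleGraph V} (hHG : H ≤ G) {u v w : V}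
    {p : G.Walk u v} (hp : (p.length : ℕ∞) = G.edist u v)
    (hviol : G.edist u v + 2 < H.edist u v) {i : ℕ} (hi : i ≤ p.length)
    (hw : H.Adj (p.getVert i) w) :
    deficit G (H.addWalk p) u w < deficit G H u w ∨
      deficit G (H.addWalk p) v w < deficit G H v w := by
  have hle : H ≤ H.addWalk p := le_sup_left
  have hG := addWalk_le hHG p
  have hadj' := (edist_eq_one_iff_adj.2 (hle hw)).le
  have hadjG := (edist_eq_one_iff_adj.2 (hHG hw)).le
  have hlow := le_edist_getVert hp hi
  have hup := edist_addWalk_le H p hi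
  have hu : (H.addWalk p).edist u w ≤ i + 1 :=
    SimpleGraph.edist_triangle.trans (add_le_add hup.1 hadj')
  have hv : (H.addWalk p).edist v w ≤ (p.length - i : ℕ) + 1 :=
    SimpleGraph.edist_triangle.trans (add_le_add (by rw [edist_comm]; exact hup.2) hadj')
  by_cases hcase : H.edist u w ≤ i + 1
  · right
    refine deficit_lt hle hG (hv.trans ?_) (hv.trans_lt ?_)
    · have h1 : ((p.length - i : ℕ) : ℕ∞) ≤ G.edist v w + 1 :=
        hlow.2.trans <| by
          rw [edist_comm]
          exact SimpleGraph.edist_triangle.trans (add_le_add le_rfl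
            (by rw [edist_comm]; exact hadjG))
      calc _ ≤ G.edist v w + 1 + 1 := add_le_add h1 le_rfl
        _ = _ := by rw [add_assoc]; rfl
    · by_contra! hcase'
      rw [edist_comm] at hcase'
      refine hviol.not_ge (SimpleGraph.edist_triangle.trans ((add_le_add hcase hcase').trans ?_))
      rw [← hp]
      have h2 : i + 1 + (p.length - i + 1) ≤ p.length + 2 := by omega
      exact_mod_cast h2
  · left
    rw [not_le] at hcase
    refine deficit_lt hle hG (hu.trans ?_) (hu.trans_lt hcase)
    have h1 : (i : ℕ∞) ≤ G.edist u w + 1 :=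
        hlow.1.trans (SimpleGraph.edist_triangle.trans (add_le_add le_rfl
          (by rw [edist_comm]; exact hadjG)))
    calc _ ≤ G.edist u w + 1 + 1 := add_le_add h1 le_rfl
      _ = _ := by rw [add_assoc]; rfl

/-- No deficit grows, and each `w` in `W` lowers the one at `u` or the one at `v` by at least 1. -/
theorem totalDeficit_addWalk_add_le [Fintype V] {G H : SimpleGraph V} (hHG : H ≤ G)
    {S : Finset V} {u v : V} (hu : u ∈ S) (hv : v ∈ S)
    {p : G.Walk u v} (hp : (p.length : ℕ∞) = G.edist u v)
    (hviol : G.edist u v + 2 < H.edist u v) (W : Finset V)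
    (hW : ∀ w, w ∈ W ↔ ∃ i ∈ H.missing p, H.Adj (p.getVert i) w) :
    totalDeficit G (H.addWalk p) S + W.card ≤ totalDeficit G H S := by
  classical
  have hanti : ∀ w, ∀ s ∈ S, deficit G (H.addWalk p) s w ≤ deficit G H s w :=
    fun w s _ => deficit_anti le_sup_left s w
  have hcard : W.card = ∑ w, if w ∈ W then 1 else 0 := by simp
  rw [totalDeficit, totalDeficit, hcard, ← Finset.sum_add_distrib]
  refine Finset.sum_le_sum fun w _ => ?_
  split_ifs with hw
  · obtain ⟨i, hi, hadj⟩ := (hW w).1 hw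
    refine Finset.sum_lt_sum (hanti w) ?_
    rcases deficit_addWalk_lt hHG hp hviol (mem_missing.1 hi).1.le hadj with h | h
    exacts [⟨u, hu, h⟩, ⟨v, hv, h⟩]
  · exact Finset.sum_le_sum (hanti w)

/-- Adding a shortest path between two terminals of too large distance is paid for by the
decrease of the potential. -/
theorem addWalk_potential_le [Fintype V] {G H : SimpleGraph V} (hHG : H ≤ G) {h : ℕ}
    (hinit : ∀ x, (∀ y, G.Adj x y → H.Adj x y) ∨ h ≤ {y | H.Adj x y}.ncard)
    {S : Finset V} {u v : V} (hu : u ∈ S) (hv : v ∈ S)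
    {p : G.Walk u v} (hp : (p.length : ℕ∞) = G.edist u v)
    (hviol : G.edist u v + 2 < H.edist u v) :
    (H.addWalk p).edgeSet.ncard * h + 3 * totalDeficit G (H.addWalk p) S ≤
      H.edgeSet.ncard * h + 3 * totalDeficit G H S := by
  classical
  set W : Finset V := Finset.univ.filter fun w => ∃ i ∈ H.missing p, H.Adj (p.getVert i) w with hWd
  have hW : ∀ w, w ∈ W ↔ ∃ i ∈ H.missing p, H.Adj (p.getVert i) w := by simp [hWd]
  have h1 := Nat.mul_le_mul_right h (ncard_edgeSet_addWalk_le H p)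
  have h2 := card_missing_mul_le hHG hinit hp W hW
  have h3 := totalDeficit_addWalk_add_le hHG hu hv hp hviol W hW
  rw [Nat.add_mul] at h1
  omega

end SimpleGraph

/-! ### Matrices of rates and the invariant of the rounds. -/

namespace MultiPriority

open SimpleGraph

/-- `R` is a symmetric matrix with entries at most `k`, supported by the edges of `G`. -/
structure IsRateMatrix {V : Type*} (G : SimpleGraph V) (k : ℕ) (R : V → V → ℕ) : Prop where
  symm : ∀ x y, R x y = R y x
  adj : ∀ x y, 0 < R x y → G.Adj x y
  le : ∀ x y, R x y ≤ k

/-- The graph of the entries that are at least `i`. -/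
def levelGraph {V : Type*} (R : V → V → ℕ) (i : ℕ) : SimpleGraph V :=
  fromRel fun x y => i ≤ R x y

open Classical in
/-- Give rate `r` to all edges of `H` that have rate zero. -/
noncomputable def paint {V : Type*} (R : V → V → ℕ) (r : ℕ) (H : SimpleGraph V) (x y : V) : ℕ :=
  if R x y = 0 ∧ H.Adj x y then r else R x y

theorem paint_of_adj {V : Type*} {R : V → V → ℕ} {r : ℕ} {H : SimpleGraph V} {x y : V}
    (h0 : R x y = 0) (h : H.Adj x y) : paint R r H x y = r := if_pos ⟨h0, h⟩

theorem paint_congr {V : Type*} {R : V → V → ℕ} {r : ℕ} {H H' : SimpleGraph V} {x y : V}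
    (h : H.Adj x y ↔ H'.Adj x y) : paint R r H x y = paint R r H' x y := by
  unfold paint
  split_ifs <;> first | rfl | tauto

section Matrix

variable {V : Type*} {G H : SimpleGraph V} {k r i : ℕ} {R : V → V → ℕ}

theorem IsRateMatrix.levelGraph_adj (hR : IsRateMatrix G k R) (hi : 1 ≤ i) {x y : V} :
    (levelGraph R i).Adj x y ↔ i ≤ R x y := by
  rw [levelGraph, fromRel_adj, hR.symm y x, or_self, and_iff_right_iff_imp]
  exact fun h => (hR.adj x y (by omega)).ne

theorem IsRateMatrix.levelGraph_le (hR : IsRateMatrix G k R) (hi : 1 ≤ i) : levelGraph R i ≤ G :=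
  fun x y h => hR.adj x y (by have := (hR.levelGraph_adj hi).1 h; omega)

theorem le_paint (R : V → V → ℕ) (r : ℕ) (H : SimpleGraph V) (x y : V) :
    R x y ≤ paint R r H x y := by
  rw [paint]; split_ifs with h
  exacts [by omega, le_rfl]

theorem IsRateMatrix.paint (hR : IsRateMatrix G k R) (hH : H ≤ G) (hr : r ≤ k) :
    IsRateMatrix G k (paint R r H) where
  symm x y := by
    classical
    exact if_congr (by rw [hR.symm, H.adj_comm]) rfl (hR.symm x y)
  adj x y h := by
    rw [MultiPriority.paint] at h
    split_ifs at h with h'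
    exacts [hH h'.2, hR.adj x y h]
  le x y := by
    rw [MultiPriority.paint]
    split_ifs
    exacts [hr, hR.le x y]

theorem IsRateMatrix.paint_self (hR : IsRateMatrix G k R) :
    MultiPriority.paint R r (levelGraph R 1) = R := by
  funext x y
  rw [MultiPriority.paint, if_neg]
  rintro ⟨h1, h2⟩
  have := (hR.levelGraph_adj le_rfl).1 h2
  omega

theorem IsRateMatrix.paint_pos (hR : IsRateMatrix G k R) (hH : levelGraph R 1 ≤ H) (hr : 0 < r)
    {x y : V} : 0 < MultiPriority.paint R r H x y ↔ H.Adj x y := by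
  rw [MultiPriority.paint]
  split_ifs with h
  · simp [hr, h.2]
  · constructor
    · exact fun h' => hH ((hR.levelGraph_adj le_rfl).2 h')
    · exact fun h' => Nat.pos_of_ne_zero fun h0 => h ⟨h0, h'⟩

/-- Newly painted edges have rate exactly `r`, so they count for the levels up to `r` and for no
other. -/
theorem IsRateMatrix.ncard_levelGraph_paint_le [Finite V] (hR : IsRateMatrix G k R) (hHG : H ≤ G)
    (hr : r ≤ k) (hH : levelGraph R 1 ≤ H) (hi : 1 ≤ i) :
    (levelGraph (MultiPriority.paint R r H) i).edgeSet.ncard ≤ (levelGraph R i).edgeSet.ncard +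
      if i ≤ r then H.edgeSet.ncard - (levelGraph R 1).edgeSet.ncard else 0 := by
  have hP := hR.paint hHG hr
  split_ifs with hir
  · rw [← Set.ncard_sdiff (edgeSet_mono hH)]
    refine (Set.ncard_le_ncard ?_ (Set.toFinite _)).trans (Set.ncard_union_le _ _)
    intro e he
    induction e with
    | h x y =>
      rw [mem_edgeSet, hP.levelGraph_adj hi, MultiPriority.paint] at he
      rw [Set.mem_union, Set.mem_sdiff, mem_edgeSet, mem_edgeSet, mem_edgeSet,
        hR.levelGraph_adj hi, hR.levelGraph_adj le_rfl]
      split_ifs at he with h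
      exacts [Or.inr ⟨h.2, by omega⟩, Or.inl he]
  · refine Set.ncard_le_ncard ?_ (Set.toFinite _)
    refine edgeSet_mono fun x y he => ?_
    rw [hP.levelGraph_adj hi, MultiPriority.paint] at he
    rw [hR.levelGraph_adj hi]
    split_ifs at he with h
    exacts [absurd he hir, he]

end Matrix

/-- `r` is the largest level with at least `m` terminals, and zero if there is none. -/
def Instance.IsThreshold (I : Instance) (m r : ℕ) : Prop :=
  ∀ i, 1 ≤ i → (i ≤ r ↔ m ≤ (I.terminals i).card)

theorem Instance.IsThreshold.le {I : Instance} {m r : ℕ} (hr : I.IsThreshold m r) (hm : 0 < m) :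
    r ≤ I.k := by
  rcases Nat.eq_zero_or_pos r with h | h
  · omega
  · have h1 := (hr r h).1 le_rfl
    obtain ⟨v, hv⟩ := Finset.card_pos.1 (hm.trans_le h1)
    have := (Finset.mem_filter.1 hv).2
    have := (I.priority v).2
    omega

/-- `∑ 2 ^ j'` over those `j' < j` with `4 ^ j' ≤ t`. -/
def roundWeight (t : ℕ) : ℕ → ℕ
  | 0 => 0
  | j + 1 => roundWeight t j + if 4 ^ j ≤ t then 2 ^ j else 0

/-- The geometric bound 2 ^ j is carried along for the induction: when a term 2 ^ j with 4 ^ j ≤ t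
enters, the sum is at most 2 ^ (j + 1), whose square is 4 * 4 ^ j ≤ 4 * t. -/
theorem roundWeight_sq_le (t j : ℕ) : roundWeight t j ≤ 2 ^ j ∧ roundWeight t j ^ 2 ≤ 4 * t := by
  induction j with
  | zero => simp [roundWeight]
  | succ j ih =>
    rw [roundWeight]
    split_ifs with h
    · have h1 : roundWeight t j + 2 ^ j ≤ 2 ^ (j + 1) := by rw [pow_succ]; omega
      refine ⟨h1, (Nat.pow_le_pow_left h1 2).trans ?_⟩
      rw [← pow_mul, mul_comm, pow_mul, pow_succ]
      norm_num
      omega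
    · exact ⟨by rw [pow_succ]; omega, by simpa using ih.2⟩

/-- The rates computed before round `j`. -/
structure Instance.RoundInvariant (I : Instance) (j : ℕ) (R : Fin I.n → Fin I.n → ℕ) : Prop where
  matrix : IsRateMatrix I.graph I.k R
  high : ∀ x y, 0 < R x y → ∀ i, 1 ≤ i → 4 ^ j ≤ (I.terminals i).card → i ≤ R x y
  spanner : ∀ i, 1 ≤ i → (I.terminals i).card < 4 ^ j → ∀ u ∈ I.terminals i,
    ∀ v ∈ I.terminals i, (levelGraph R i).edist u v ≤ I.graph.edist u v + 2
  size : ∀ i, 1 ≤ i →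
    (levelGraph R i).edgeSet.ncard ≤ 37 * I.n * roundWeight (I.terminals i).card j

theorem Instance.roundInvariant_zero (I : Instance) : I.RoundInvariant 0 fun _ _ => 0 := by
  have h : ∀ i, 1 ≤ i → levelGraph (fun _ _ : Fin I.n => 0) i = ⊥ := by
    intro i hi
    ext x y
    simp [levelGraph, show i ≠ 0 by omega]
  refine ⟨⟨by simp, by simp, by simp⟩, by simp, fun i hi ht u hu => ?_, fun i hi => ?_⟩
  · simp only [pow_zero, Nat.lt_one_iff, Finset.card_eq_zero] at ht
    simp [ht] at hu
  · simp [h i hi]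

variable {I : Instance} {j r q : ℕ} {R : Fin I.n → Fin I.n → ℕ}

/-- No level has 4 ^ j terminals, so the round has nothing to treat. It has to be skipped, because
rate 0 stands for a non-edge. -/
theorem Instance.RoundInvariant.succ_of_threshold_zero (h : I.RoundInvariant j R)
    (hr : I.IsThreshold (4 ^ j) 0) : I.RoundInvariant (j + 1) R where
  matrix := h.matrix
  high x y hxy i hi ht := h.high x y hxy i hi
    ((Nat.pow_le_pow_right (by omega) (Nat.le_succ j)).trans ht)
  spanner i hi _ := h.spanner i hi (by have := hr i hi; omega)
  size i hi := (h.size i hi).trans (Nat.mul_le_mul_left _ (Nat.le_add_right _ _))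

/-- The levels treated are those with q < i ≤ r. By `high` the old edges have rate at least i, and
the new ones have rate r, so level i contains all of `H`; as its terminals have priority above q,
`hspan` applies to them. -/
theorem Instance.RoundInvariant.succ (h : I.RoundInvariant j R)
    (hr : I.IsThreshold (4 ^ j) r) (hq : I.IsThreshold (4 ^ (j + 1)) q)
    {H : SimpleGraph (Fin I.n)} (hHG : H ≤ I.graph) (hRH : levelGraph R 1 ≤ H)
    (hcard : H.edgeSet.ncard ≤ (levelGraph R 1).edgeSet.ncard + 37 * I.n * 2 ^ j)
    (hspan : ∀ u v, q < I.priority u → q < I.priority v → H.edist u v ≤ I.graph.edist u v + 2) :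
    I.RoundInvariant (j + 1) (paint R r H) := by
  have hrk := hr.le (by positivity)
  have hpow : 4 ^ j ≤ 4 ^ (j + 1) := Nat.pow_le_pow_right (by omega) (Nat.le_succ j)
  have hP := h.matrix.paint hHG hrk
  refine ⟨hP, fun x y hxy i hi ht => ?_, fun i hi ht u hu v hv => ?_, fun i hi => ?_⟩
  · rw [paint] at hxy ⊢
    split_ifs at hxy ⊢
    · exact (hr i hi).2 (hpow.trans ht)
    · exact h.high x y hxy i hi (hpow.trans ht)
  · by_cases htj : (I.terminals i).card < 4 ^ j
    · refine (edist_anti fun x y hxy => ?_).trans (h.spanner i hi htj u hu v hv)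
      rw [hP.levelGraph_adj hi]
      exact ((h.matrix.levelGraph_adj hi).1 hxy).trans (le_paint ..)
    · have hir : i ≤ r := (hr i hi).2 (by omega)
      have hqi : q < i := by have := hq i hi; omega
      refine (edist_anti fun x y hxy => ?_).trans (hspan u v
        (hqi.trans_le (Finset.mem_filter.1 hu).2) (hqi.trans_le (Finset.mem_filter.1 hv).2))
      rw [hP.levelGraph_adj hi, paint]
      split_ifs with h'
      · exact hir
      · exact h.high x y (Nat.pos_of_ne_zero fun h0 => h' ⟨h0, hxy⟩) i hi (by omega)
  · refine (h.matrix.ncard_levelGraph_paint_le hHG hrk hRH hi).trans ?_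
    rw [roundWeight, Nat.mul_add]
    refine Nat.add_le_add (h.size i hi) ?_
    split_ifs with h1 h2 h2
    · omega
    · exact absurd ((hr i hi).1 h1) h2
    · exact Nat.zero_le _
    · exact le_rfl

/-- The rated subgraph with given rates. -/
def IsRateMatrix.toRatedSubgraph (hR : IsRateMatrix I.graph I.k R) :
    RatedSubgraph I.graph I.k where
  graph := levelGraph R 1
  le := hR.levelGraph_le le_rfl
  rate := Sym2.lift ⟨R, hR.symm⟩
  rate_mem e he := by
    induction e with
    | h x y => exact ⟨(hR.levelGraph_adj le_rfl).1 he, hR.le x y⟩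

theorem IsRateMatrix.level_toRatedSubgraph (hR : IsRateMatrix I.graph I.k R) {i : ℕ} (hi : 1 ≤ i) :
    hR.toRatedSubgraph.level i = levelGraph R i := by
  ext x y
  simp only [RatedSubgraph.level, toRatedSubgraph, Sym2.lift_mk, hR.levelGraph_adj hi,
    hR.levelGraph_adj le_rfl]
  omega

theorem Instance.RoundInvariant.isAdditiveSpanner (h : I.RoundInvariant I.n R) {β : ℕ}
    (hβ : 2 ≤ β) : I.IsAdditiveSpanner β h.matrix.toRatedSubgraph := by
  intro i hi
  -- Since |T_i| ≤ n < 4 ^ n, every level has been treated after n rounds.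
  have hlt : (I.terminals i).card < 4 ^ I.n :=
    ((Finset.card_le_univ _).trans_eq (Fintype.card_fin _)).trans_lt (Nat.lt_pow_self (by omega))
  have hs := h.spanner i hi.1 hlt
  rw [h.matrix.level_toRatedSubgraph hi.1]
  refine ⟨h.matrix.levelGraph_le hi.1, fun u hu v hv huv => ?_, fun u hu v hv => ?_⟩
  · rw [← edist_ne_top_iff_reachable, ← lt_top_iff_ne_top] at huv ⊢
    exact (hs u hu v hv).trans_lt (ENat.add_lt_top.2 ⟨huv, by decide⟩)
  · exact (hs u hu v hv).trans (by gcongr; exact_mod_cast hβ)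

theorem Instance.RoundInvariant.sizeBound (h : I.RoundInvariant I.n R) {f : ℕ → ℕ → ℝ}
    (hf : ∀ n t : ℕ, 74 * (n * (t : ℝ) ^ ((1 : ℝ) / 2)) ≤ f n t) :
    I.SizeBound f h.matrix.toRatedSubgraph := by
  have key : ∀ i, 1 ≤ i →
      ((levelGraph R i).edgeSet.ncard : ℝ) ≤ f I.n (I.terminals i).card := by
    intro i hi
    refine le_trans ?_ (hf _ _)
    have h1 : ((levelGraph R i).edgeSet.ncard : ℝ) ≤
        37 * I.n * roundWeight (I.terminals i).card I.n := by exact_mod_cast h.size i hi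
    -- This factor 2 turns 37 into 74.
    have h2 : (roundWeight (I.terminals i).card I.n : ℝ) ≤
        2 * ((I.terminals i).card : ℝ) ^ ((1 : ℝ) / 2) := by
      rw [← Real.sqrt_eq_rpow]
      refine le_of_sq_le_sq ?_ (by positivity)
      rw [mul_pow, Real.sq_sqrt (Nat.cast_nonneg _)]
      exact_mod_cast (roundWeight_sq_le _ I.n).2
    calc _ ≤ _ := h1
      _ ≤ 37 * I.n * (2 * ((I.terminals i).card : ℝ) ^ ((1 : ℝ) / 2)) := by gcongr
      _ = _ := by ring
  refine ⟨key 1 le_rfl, fun i hi => ?_⟩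
  rw [h.matrix.level_toRatedSubgraph hi.1]
  exact key i hi.1

/-- The condition that the initialization of a round establishes: every vertex has kept all its
edges, or at least `h` of them. -/
def KeepsDegree {V : Type*} (G : SimpleGraph V) (h : ℕ) (H : SimpleGraph V) (x : V) : Prop :=
  (∀ y, G.Adj x y → H.Adj x y) ∨ h ≤ {y | H.Adj x y}.ncard

theorem KeepsDegree.mono {V : Type*} [Finite V] {G H H' : SimpleGraph V} {h : ℕ} {x : V}
    (hx : KeepsDegree G h H x) (hH : H ≤ H') : KeepsDegree G h H' x :=
  hx.imp (fun ha y hy => hH (ha y hy))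
    fun hc => hc.trans (Set.ncard_le_ncard (fun _ hy => hH hy) (Set.toFinite _))

/-- The initial deficit term is at most 3 * (n * 3 * |S|) ≤ 36 * n * h ^ 2, and each edge costs h of
it. -/
theorem ncard_le_of_potential_le {n h : ℕ} {G H H' : SimpleGraph (Fin n)}
    {S : Finset (Fin n)} (hS : S.card ≤ 4 * h ^ 2) (hh : 0 < h)
    (hpot : H'.edgeSet.ncard * h + 3 * totalDeficit G H' S ≤
      H.edgeSet.ncard * h + 3 * totalDeficit G H S) :
    H'.edgeSet.ncard ≤ H.edgeSet.ncard + 36 * n * h := by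
  have h1 := totalDeficit_le G H S
  rw [Fintype.card_fin] at h1
  have h2 : n * (S.card * 3) ≤ n * (4 * h ^ 2 * 3) := by gcongr
  refine Nat.le_of_mul_le_mul_right (c := h) ?_ hh
  nlinarith

end MultiPriority

/-! ### The Bellman-Ford algorithm, independent of the machine. -/

namespace SimpleGraph

/-- `D` holds the distances from `u` in `H`, with `m` for infinity. -/
def IsDistances {n : ℕ} (H : SimpleGraph (Fin n)) (u : Fin n) (m : ℕ) (D : Fin n → ℕ) : Prop :=
  ∀ v, H.edist u v = D v ∧ D v < n ∨ H.edist u v = ⊤ ∧ D v = m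

/-- The invariant of the Bellman-Ford algorithm: `D` is correct up to distance `t`, and in the
current round the pairs in `done` have been relaxed. -/
structure BellmanFordInvariant {n : ℕ} (H : SimpleGraph (Fin n)) (u : Fin n) (m t : ℕ)
    (done : Fin n → Fin n → Prop) (D : Fin n → ℕ) : Prop where
  sound : ∀ v, H.edist u v ≤ D v ∨ D v = m
  le : ∀ v, D v ≤ m
  complete : ∀ v (p : H.Walk v u), p.length ≤ t → D v ≤ p.length
  relaxed : ∀ a b, done a b → H.Adj a b → ∀ p : H.Walk a u, p.length ≤ t → D b ≤ p.length + 1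

namespace BellmanFordInvariant

variable {n : ℕ} {H : SimpleGraph (Fin n)} {u : Fin n} {m t : ℕ} {done : Fin n → Fin n → Prop}
  {D D' : Fin n → ℕ}

theorem mono (h : BellmanFordInvariant H u m t done D) {done' : Fin n → Fin n → Prop}
    (hd : ∀ a b, done' a b → done a b) : BellmanFordInvariant H u m t done' D :=
  ⟨h.sound, h.le, h.complete, fun a b hab => h.relaxed a b (hd a b hab)⟩

/-- A walk of length at most t + 1 to `u` is trivial or a first edge followed by a walk of length at
most t; that edge has been relaxed. -/
theorem next (h : BellmanFordInvariant H u m t done D) (hd : ∀ a b, done a b)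
    {done' : Fin n → Fin n → Prop} (hd' : ∀ a b, ¬ done' a b) :
    BellmanFordInvariant H u m (t + 1) done' D := by
  refine ⟨h.sound, h.le, fun v p hp => ?_, fun a b hab => absurd hab (hd' a b)⟩
  cases p with
  | nil => exact h.complete _ .nil (by simp)
  | cons hadj q => exact h.relaxed _ _ (hd _ _) hadj.symm q (by simpa using hp)

theorem unchanged (h : BellmanFordInvariant H u m t done D) {a b : Fin n}
    (hab : H.Adj a b → D b ≤ D a + 1) :
    BellmanFordInvariant H u m t (fun x y => done x y ∨ x = a ∧ y = b) D := by
  refine ⟨h.sound, h.le, h.complete, fun x y hxy hadj p hp => ?_⟩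
  rcases hxy with hxy | ⟨rfl, rfl⟩
  · exact h.relaxed x y hxy hadj p hp
  · exact (hab hadj).trans (Nat.add_le_add_right (h.complete _ p hp) 1)

theorem relax (h : BellmanFordInvariant H u m t done D) {a b : Fin n} (hadj : H.Adj a b)
    (hab : D a + 1 < D b) :
    BellmanFordInvariant H u m t (fun x y => done x y ∨ x = a ∧ y = b)
      (Function.update D b (D a + 1)) := by
  have hle : ∀ v, Function.update D b (D a + 1) v ≤ D v := by
    intro v
    rw [Function.update_apply]
    split_ifs with hv
    · subst hv; exact hab.le
    · exact le_rfl
  refine ⟨fun v => ?_, fun v => (hle v).trans (h.le v),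
    fun v p hp => (hle v).trans (h.complete v p hp), fun x y hxy hxadj p hp => ?_⟩
  · rw [Function.update_apply]
    split_ifs with hv
    · subst hv
      refine Or.inl ?_
      -- From D a + 1 < D b ≤ m it follows that D a is not the value for infinity.
      have h1 := (h.sound a).resolve_right (by have := h.le v; omega)
      push_cast
      exact SimpleGraph.edist_triangle.trans (add_le_add h1 (edist_eq_one_iff_adj.2 hadj).le)
    · exact h.sound v
  · rcases hxy with hxy | ⟨rfl, rfl⟩
    · exact (hle y).trans (h.relaxed x y hxy hxadj p hp)
    · simpa using h.complete _ p hp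

theorem init (H : SimpleGraph (Fin n)) (u : Fin n) (m : ℕ) (hd : ∀ a b, ¬ done a b) :
    BellmanFordInvariant H u m 0 done (Function.update (fun _ => m) u 0) := by
  refine ⟨fun v => ?_, fun v => ?_, fun v p hp => ?_, fun a b hab => absurd hab (hd a b)⟩
  · rw [Function.update_apply]
    split_ifs with hv
    · subst hv; simp
    · simp
  · rw [Function.update_apply]
    split_ifs <;> omega
  · cases p with
    | nil => simp
    | cons => simp at hp

theorem isDistances (h : BellmanFordInvariant H u m n done D) (hm : n ≤ m) :
    H.IsDistances u m D := by
  intro v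
  by_cases hv : H.Reachable u v
  · obtain ⟨p, hp, hlen⟩ := hv.exists_path_of_dist
    -- A shortest path has fewer than n edges, so n rounds suffice, and finite values stay below m.
    have hlt : p.length < n := by simpa using hp.length_lt
    have h1 := h.complete v p.reverse (by simpa using hlt.le)
    rw [Walk.length_reverse, hlen] at h1
    rw [← hv.coe_dist_eq_edist]
    have h2 := (h.sound v).resolve_right (by omega)
    rw [← hv.coe_dist_eq_edist] at h2
    have h3 : H.dist u v ≤ D v := by exact_mod_cast h2
    exact Or.inl ⟨by rw [le_antisymm h1 h3], by omega⟩
  · have ht := edist_eq_top_of_not_reachable hv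
    refine Or.inr ⟨ht, (h.sound v).resolve_left ?_⟩
    simp [ht]

end BellmanFordInvariant

end SimpleGraph

/-! ### Bellman-Ford on the machine. -/

namespace RAM.Cmd

open MultiPriority SimpleGraph

/-! The rows of the memory: the priorities in row `0`, the adjacency matrix from row `1` on, the
matrix of rates from row `n + 1` on, and distances in rows `2 * n + 1` and `2 * n + 2`.

The registers: `5` and `6` hold `4 ^ j` and `2 ^ j` in round `j`, register `7` the current rate,
register `8` the priority that terminals have to exceed, registers `20`, `21`, `22` the row
numbers `n + 1`, `2 * n + 1`, `2 * n + 2`, and register `23` zero. -/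

/-- `reg 17 := row (reg B + reg x), column (reg y)` -/
def lookup (B x y : ℕ) : Cmd := add 16 B x ;; get 17 16 y

/-- Give the edge between `reg a` and `reg b` the current rate, unless it has one already. -/
def addEdge (a b : ℕ) : Cmd :=
  lookup 20 a b ;;
    ite 17 2 (put 16 b 7 ;; add 16 20 b ;; put 16 a 7) skip

/-- Relax the pair of `reg 12` and `reg 13`. -/
def relax (B d : ℕ) : Cmd :=
  lookup B 12 13 ;;
    ite 23 17 (get 17 d 12 ;; get 18 d 13 ;; add 17 17 2 ;; ite 17 18 (put d 13 17) skip) skip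

/-- Write the distances from `reg 9` into row `reg d`, for the graph whose adjacency matrix starts
in row `reg B`. -/
def bellmanFord (B d : ℕ) : Cmd :=
  loop 12 (put d 12 22) ;; put d 9 23 ;; loop 14 (loop 12 (loop 13 (relax B d)))

variable {n : ℕ}

theorem view_set (s : State) (x v : ℕ) : view n (s.set x v) = view n s := rfl

theorem mem_relax {B d : ℕ} (hB : B = 2 ∨ B = 20) (hd : d = 21 ∨ d = 22) (s : State) :
    (run n (relax B d) s).mem =
      if s.reg 23 < s.mem (n * (s.reg B + s.reg 12) + s.reg 13) then
        if s.mem (n * s.reg d + s.reg 12) + s.reg 2 < s.mem (n * s.reg d + s.reg 13) then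
          Function.update s.mem (n * s.reg d + s.reg 13) (s.mem (n * s.reg d + s.reg 12) + s.reg 2)
        else s.mem
      else s.mem := by
  rcases hB with rfl | rfl <;> rcases hd with rfl | rfl <;>
  · simp [relax, lookup, run, run_get, run_put, skip, set_reg, apply_ite State.mem]

theorem mem_put {r c y : ℕ} (hr : 5 ≤ r ∨ r < 3) (hc : 5 ≤ c ∨ c < 3)
    (hy : 5 ≤ y ∨ y < 3) (s : State) :
    (run n (put r c y) s).mem = Function.update s.mem (n * s.reg r + s.reg c) (s.reg y) := by
  rw [run_put n hr hc hy]

theorem view_of_mem_eq_update {s s' : State} {r0 v : ℕ} {c0 : Fin n}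
    (h : s'.mem = Function.update s.mem (n * r0 + c0) v) (r : ℕ) :
    view n s' r = if r = r0 then Function.update (view n s r) c0 v else view n s r := by
  funext c
  have := view_update s'.reg s.mem r0 v r c0 c
  rw [view, h]
  simp only [view] at this ⊢
  rw [this]
  by_cases hr : r = r0 <;> by_cases hc : c = c0 <;> simp [hr, hc, view]

theorem view_of_mem_eq {s s' : State} (h : s'.mem = s.mem) : view n s' = view n s := by
  funext r c
  rw [view, h, view]

/-- By `hBd` the distances lie outside the adjacency matrix, so relaxing never alters the graph.
Register 22, a row number of at least n, doubles as infinity. -/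
theorem bellmanFord_spec {B d : ℕ} (hB : B = 2 ∨ B = 20) (hd : d = 21 ∨ d = 22) {s : State}
    (h2 : s.reg 2 = 1) (h23 : s.reg 23 = 0) (h22 : n ≤ s.reg 22) {u : Fin n} (h9 : s.reg 9 = u)
    (hBd : ∀ x : Fin n, s.reg B + x ≠ s.reg d) {H : SimpleGraph (Fin n)}
    (hA : ∀ x y : Fin n, 0 < view n s (s.reg B + x) y ↔ H.Adj x y) :
    (∀ r, r ≠ s.reg d → view n (run n (bellmanFord B d) s) r = view n s r) ∧
      H.IsDistances u (s.reg 22) (view n (run n (bellmanFord B d) s) (s.reg d)) := by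
  have hreg : ∀ c : Cmd, modifies 2 c = false → modifies 23 c = false → modifies B c = false →
      modifies d c = false → modifies 22 c = false → modifies 9 c = false → ∀ s' : State,
      (∀ x, modifies x c = false → s'.reg x = s.reg x) →
      s'.reg 2 = 1 ∧ s'.reg 23 = 0 ∧ s'.reg B = s.reg B ∧ s'.reg d = s.reg d ∧
        s'.reg 22 = s.reg 22 ∧ s'.reg 9 = u := fun c m2 m23 mB md m22 m9 s' hs' =>
    ⟨(hs' _ m2).trans h2, (hs' _ m23).trans h23, hs' _ mB, hs' _ md, hs' _ m22,
      (hs' _ m9).trans h9⟩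
  set s₁ := run n (loop 12 (put d 12 22)) s with hs₁
  have hr₁ : s₁.reg 2 = 1 ∧ s₁.reg 23 = 0 ∧ s₁.reg B = s.reg B ∧ s₁.reg d = s.reg d ∧
      s₁.reg 22 = s.reg 22 ∧ s₁.reg 9 = u := by
    refine hreg (loop 12 (put d 12 22)) ?_ ?_ ?_ ?_ ?_ ?_ s₁
      fun x hx => run_reg_of_not_modifies n _ hx s
    all_goals rcases hB with rfl | rfl <;> rcases hd with rfl | rfl <;> decide
  have hv₁ : (∀ r, r ≠ s.reg d → view n s₁ r = view n s r) ∧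
      ∀ v : Fin n, (v : ℕ) < n → view n s₁ (s.reg d) v = s.reg 22 := by
    refine run_loop (fun j s' => (∀ r, r ≠ s.reg d → view n s' r = view n s r) ∧
      ∀ v : Fin n, (v : ℕ) < j → view n s' (s.reg d) v = s.reg 22) ?_ ?_
    · simp [view_set]
    · intro j s' hj h12 hs' ⟨ih1, ih2⟩
      have e1 : s'.reg d = s.reg d := hs' d (by rcases hd with rfl | rfl <;> decide)
      have e2 : s'.reg 22 = s.reg 22 := hs' 22 (by rcases hd with rfl | rfl <;> decide)
      have hm := mem_put (n := n) (r := d) (c := 12) (y := 22) (by omega) (by omega) (by omega) s'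
      rw [h12, e1, e2] at hm
      have hv := view_of_mem_eq_update (c0 := ⟨j, hj⟩) hm
      rw [view_set]
      refine ⟨fun r hr => by rw [hv, if_neg hr, ih1 r hr], fun v hv' => ?_⟩
      rw [hv, if_pos rfl, Function.update_apply]
      split_ifs with h
      · rfl
      · exact ih2 v (by have : (v : ℕ) ≠ j := fun h' => h (Fin.ext h'); omega)
  set s₂ := run n (put d 9 23) s₁ with hs₂
  have hr₂ : s₂.reg 2 = 1 ∧ s₂.reg 23 = 0 ∧ s₂.reg B = s.reg B ∧ s₂.reg d = s.reg d ∧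
      s₂.reg 22 = s.reg 22 ∧ s₂.reg 9 = u := by
    have hp : ∀ x, modifies x (put d 9 23) = false → s₂.reg x = s₁.reg x :=
      fun x hx => run_reg_of_not_modifies n _ hx s₁
    refine ⟨(hp _ ?_).trans hr₁.1, (hp _ ?_).trans hr₁.2.1, (hp _ ?_).trans hr₁.2.2.1,
      (hp _ ?_).trans hr₁.2.2.2.1, (hp _ ?_).trans hr₁.2.2.2.2.1, (hp _ ?_).trans hr₁.2.2.2.2.2⟩
    all_goals rcases hB with rfl | rfl <;> rcases hd with rfl | rfl <;> decide
  have hv₂ : (∀ r, r ≠ s.reg d → view n s₂ r = view n s r) ∧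
      view n s₂ (s.reg d) = Function.update (fun _ => s.reg 22) u 0 := by
    have hm := mem_put (n := n) (r := d) (c := 9) (y := 23) (by omega) (by omega) (by omega) s₁
    rw [hr₁.2.2.2.1, hr₁.2.2.2.2.2, hr₁.2.1] at hm
    have hv := view_of_mem_eq_update hm
    refine ⟨fun r hr => by rw [hv, if_neg hr, hv₁.1 r hr], ?_⟩
    rw [hv, if_pos rfl]
    congr 1
    funext v
    exact hv₁.2 v v.2
  let Inv : ℕ → (Fin n → Fin n → Prop) → State → Prop := fun t done s' =>
    (∀ r, r ≠ s.reg d → view n s' r = view n s r) ∧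
      BellmanFordInvariant H u (s.reg 22) t done (view n s' (s.reg d))
  suffices h : Inv n (fun _ _ => False) (run n (loop 14 (loop 12 (loop 13 (relax B d)))) s₂) from
    ⟨h.1, h.2.isDistances h22⟩
  have step : ∀ t (done : Fin n → Fin n → Prop) (a b : Fin n) s',
      s'.reg 2 = 1 → s'.reg 23 = 0 → s'.reg B = s.reg B → s'.reg d = s.reg d →
      s'.reg 12 = (a : ℕ) → s'.reg 13 = (b : ℕ) → Inv t done s' →
      Inv t (fun x y => done x y ∨ x = a ∧ y = b) (run n (relax B d) s') := by
    intro t done a b s' e2 e23 eB ed e12 e13 hI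
    have hm := mem_relax (n := n) hB hd s'
    rw [e2, e23, eB, ed, e12, e13] at hm
    have hAab : 0 < s'.mem (n * (s.reg B + a) + b) ↔ H.Adj a b := by
      rw [← hA, ← hI.1 _ (hBd a)]; rfl
    split_ifs at hm with h1 h2
    · have hv := view_of_mem_eq_update hm
      refine ⟨fun r hr => by rw [hv, if_neg hr, hI.1 r hr], ?_⟩
      rw [hv, if_pos rfl]
      exact hI.2.relax (hAab.1 h1) h2
    · have hv := view_of_mem_eq (n := n) hm
      exact ⟨by rw [hv]; exact hI.1, by rw [hv]; exact hI.2.unchanged fun _ => not_lt.1 h2⟩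
    · have hv := view_of_mem_eq (n := n) hm
      exact ⟨by rw [hv]; exact hI.1, by rw [hv]; exact hI.2.unchanged fun h => absurd (hAab.2 h) h1⟩
  refine run_loop (fun t s' => Inv t (fun _ _ => False) s') ⟨by rw [view_set]; exact hv₂.1, ?_⟩ ?_
  · rw [view_set, hv₂.2]
    exact BellmanFordInvariant.init _ _ _ fun _ _ => id
  intro t s₃ ht e14 hs₃ hI₃
  have key : Inv t (fun a _ => (a : ℕ) < n) (run n (loop 12 (loop 13 (relax B d))) s₃) := by
    refine run_loop (fun a s' => Inv t (fun x _ => (x : ℕ) < a) s')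
      ⟨by rw [view_set]; exact hI₃.1, by rw [view_set]; exact hI₃.2.mono (by simp)⟩ ?_
    intro a s₄ ha e12 hs₄ hI₄
    have key' : Inv t (fun x y => (x : ℕ) < a ∨ x = ⟨a, ha⟩ ∧ (y : ℕ) < n)
        (run n (loop 13 (relax B d)) s₄) := by
      refine run_loop (fun b s' => Inv t (fun x y => (x : ℕ) < a ∨ x = ⟨a, ha⟩ ∧ (y : ℕ) < b) s')
        ⟨by rw [view_set]; exact hI₄.1, by rw [view_set]; exact hI₄.2.mono (by simp)⟩ ?_
      intro b s₅ hb e13 hs₅ hI₅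
      have e : ∀ x, modifies x (loop 14 (loop 12 (loop 13 (relax B d)))) = false →
          s₅.reg x = s₂.reg x := by
        intro x hx
        have hx' := hx
        simp only [modifies, Bool.or_eq_false_iff] at hx'
        rw [hs₅ x (by simp only [modifies, Bool.or_eq_false_iff]; exact hx'.2.2),
          hs₄ x (by simp only [modifies, Bool.or_eq_false_iff]; exact hx'.2),
          hs₃ x hx]
      have e12' : s₅.reg 12 = a := by
        rw [hs₅ 12 (by rcases hB with rfl | rfl <;> rcases hd with rfl | rfl <;> decide), e12]
      have := step t _ ⟨a, ha⟩ ⟨b, hb⟩ s₅ ((e 2 ?_).trans hr₂.1) ((e 23 ?_).trans hr₂.2.1)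
        ((e B ?_).trans hr₂.2.2.1) ((e d ?_).trans hr₂.2.2.2.1) e12' e13 hI₅
      · refine ⟨this.1, this.2.mono fun x y hxy => ?_⟩
        rcases hxy with hxy | ⟨rfl, hy⟩
        · exact Or.inl (Or.inl hxy)
        · rcases Nat.lt_succ_iff_lt_or_eq.1 hy with hy | hy
          · exact Or.inl (Or.inr ⟨rfl, hy⟩)
          · exact Or.inr ⟨rfl, Fin.ext hy⟩
      all_goals rcases hB with rfl | rfl <;> rcases hd with rfl | rfl <;> decide
    refine ⟨key'.1, key'.2.mono fun x y hx => ?_⟩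
    rcases Nat.lt_succ_iff_lt_or_eq.1 hx with hx | hx
    exacts [Or.inl hx, Or.inr ⟨Fin.ext hx, y.2⟩]
  exact ⟨key.1, key.2.next (fun a _ => a.2) fun _ _ => id⟩

end RAM.Cmd

/-! ### Adding edges, and the initial edges of a round. -/

namespace RAM.Cmd

open MultiPriority SimpleGraph

variable {I : Instance} {R : Fin I.n → Fin I.n → ℕ} {H : SimpleGraph (Fin I.n)} {s s' : State}

/-- The state holds the instance `I` and the constants that the algorithm uses. -/
structure Layout (I : Instance) (s : State) : Prop where
  reg_two : s.reg 2 = 1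
  reg_20 : s.reg 20 = I.n + 1
  reg_21 : s.reg 21 = 2 * I.n + 1
  reg_22 : s.reg 22 = 2 * I.n + 2
  reg_23 : s.reg 23 = 0
  priority : ∀ v, view I.n s 0 v = I.priority v
  adj : ∀ u v : Fin I.n, 0 < view I.n s (1 + u) v ↔ I.graph.Adj u v

theorem Layout.congr (h : Layout I s)
    (hreg : ∀ x ∈ [2, 20, 21, 22, 23], s'.reg x = s.reg x)
    (hrow : ∀ r ≤ I.n, view I.n s' r = view I.n s r) : Layout I s' where
  reg_two := (hreg 2 (by simp)).trans h.reg_two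
  reg_20 := (hreg 20 (by simp)).trans h.reg_20
  reg_21 := (hreg 21 (by simp)).trans h.reg_21
  reg_22 := (hreg 22 (by simp)).trans h.reg_22
  reg_23 := (hreg 23 (by simp)).trans h.reg_23
  priority v := by rw [hrow 0 (Nat.zero_le _), h.priority]
  adj u v := by rw [hrow _ (by omega), h.adj]

/-- The state holds the rates `R`, and in addition the current rate for all other edges of `H`. -/
structure Painted (I : Instance) (R : Fin I.n → Fin I.n → ℕ) (H : SimpleGraph (Fin I.n))
    (s : State) : Prop where
  layout : Layout I s
  matrix : IsRateMatrix I.graph I.k R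
  pos : 0 < s.reg 7
  ge : levelGraph R 1 ≤ H
  le : H ≤ I.graph
  view_eq : ∀ x y : Fin I.n, view I.n s (I.n + 1 + x) y = paint R (s.reg 7) H x y

theorem Painted.congr (h : Painted I R H s)
    (hreg : ∀ x ∈ [2, 7, 20, 21, 22, 23], s'.reg x = s.reg x)
    (hrow : ∀ r ≤ 2 * I.n, view I.n s' r = view I.n s r) : Painted I R H s' where
  layout := h.layout.congr (fun x hx => hreg x (by simp at hx ⊢; tauto))
    fun r hr => hrow r (by omega)
  matrix := h.matrix
  pos := by rw [hreg 7 (by simp)]; exact h.pos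
  ge := h.ge
  le := h.le
  view_eq x y := by rw [hrow _ (by omega), hreg 7 (by simp), h.view_eq]

theorem Painted.set (h : Painted I R H s) {x v : ℕ} (hx : x ∉ [2, 7, 20, 21, 22, 23]) :
    Painted I R H (s.set x v) :=
  h.congr (fun y hy => by rw [set_reg, if_neg]; rintro rfl; exact hx hy) fun _ _ => rfl

theorem Painted.pos_iff (h : Painted I R H s) (x y : Fin I.n) :
    0 < view I.n s (I.n + 1 + x) y ↔ H.Adj x y := by
  rw [h.view_eq, h.matrix.paint_pos h.ge h.pos]

theorem Painted.congr_run (h : Painted I R H s) {c : Cmd}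
    (hc : ∀ x ∈ [2, 7, 20, 21, 22, 23], modifies x c = false)
    (hmem : ∀ r ≤ 2 * I.n, view I.n (run I.n c s) r = view I.n s r) :
    Painted I R H (run I.n c s) :=
  h.congr (fun x hx => run_reg_of_not_modifies _ _ (hc x hx) s) hmem

theorem run_lookup (n : ℕ) {B x y : ℕ} (hy : 5 ≤ y ∧ y ≠ 16 ∨ y < 3) (s : State) :
    (run n (lookup B x y) s).mem = s.mem ∧
      (run n (lookup B x y) s).reg 17 = s.mem (n * (s.reg B + s.reg x) + s.reg y) := by
  simp only [lookup, run]
  rw [run_get n (by omega) (by omega)]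
  have : y ≠ 16 := by omega
  simp [set_reg, this]

theorem mem_addEdge (n : ℕ) {a b : ℕ} (hab : a = 12 ∧ b = 13 ∨ a = 13 ∧ b = 15) (s : State) :
    (run n (addEdge a b) s).mem =
      if s.mem (n * (s.reg 20 + s.reg a) + s.reg b) < s.reg 2 then
        Function.update (Function.update s.mem (n * (s.reg 20 + s.reg a) + s.reg b) (s.reg 7))
          (n * (s.reg 20 + s.reg b) + s.reg a) (s.reg 7)
      else s.mem := by
  rcases hab with ⟨rfl, rfl⟩ | ⟨rfl, rfl⟩ <;>
    simp [addEdge, lookup, run, run_get, run_put, skip, set_reg, apply_ite State.mem]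

/-- Only entries equal to zero are written, both for the edge and for its reverse, so earlier rates
survive. -/
theorem addEdge_spec (h : Painted I R H s) {ra rb : ℕ}
    (hab : ra = 12 ∧ rb = 13 ∨ ra = 13 ∧ rb = 15) {a b : Fin I.n}
    (ha : s.reg ra = a) (hb : s.reg rb = b) (hadj : I.graph.Adj a b) :
    Painted I R (H ⊔ edge a b) (run I.n (addEdge ra rb) s) ∧
      ∀ r, 2 * I.n < r → view I.n (run I.n (addEdge ra rb) s) r = view I.n s r := by
  have hreg : ∀ x ∈ [2, 7, 20, 21, 22, 23], (run I.n (addEdge ra rb) s).reg x = s.reg x :=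
    fun x hx => run_reg_of_not_modifies _ _ ((by
      rcases hab with ⟨rfl, rfl⟩ | ⟨rfl, rfl⟩ <;> decide :
        ∀ x ∈ [2, 7, 20, 21, 22, 23], modifies x (addEdge ra rb) = false) x hx) s
  have hm := mem_addEdge I.n hab s
  rw [ha, hb, h.layout.reg_20, h.layout.reg_two] at hm
  have hcond : s.mem (I.n * (I.n + 1 + a) + b) < 1 ↔ ¬ H.Adj a b := by
    rw [← h.pos_iff, view]; omega
  split_ifs at hm with hlt
  · rw [hcond] at hlt
    set s₁ : State := ⟨s.reg, Function.update s.mem (I.n * (I.n + 1 + a) + b) (s.reg 7)⟩ with hs₁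
    have hv₁ := view_of_mem_eq_update (s := s) (s' := s₁) (c0 := b) rfl
    have hv₂ := view_of_mem_eq_update (s := s₁) (s' := run I.n (addEdge ra rb) s) (c0 := a) hm
    have hv : ∀ r, (∀ x : Fin I.n, r ≠ I.n + 1 + x) →
        view I.n (run I.n (addEdge ra rb) s) r = view I.n s r := by
      intro r hr
      rw [hv₂, if_neg (hr b), hv₁, if_neg (hr a)]
    refine ⟨⟨h.layout.congr (fun x hx => hreg x (by simp at hx ⊢; tauto))
      fun r hr => hv r fun x => by omega, h.matrix, by rw [hreg 7 (by simp)]; exact h.pos,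
      h.ge.trans le_sup_left, sup_le h.le ?_, fun x y => ?_⟩, fun r hr => hv r fun x => by omega⟩
    · intro x y hxy
      rw [edge_adj] at hxy
      rcases hxy.1 with ⟨rfl, rfl⟩ | ⟨rfl, rfl⟩
      exacts [hadj, hadj.symm]
    · have hzero : R a b = 0 := by
        by_contra h0
        exact hlt (h.ge ((h.matrix.levelGraph_adj le_rfl).2 (Nat.pos_of_ne_zero h0)))
      have hzero' : R b a = 0 := by rw [h.matrix.symm, hzero]
      have hx := h.view_eq x y
      have hne := hadj.ne
      rw [hreg 7 (by simp), hv₂, hv₁]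
      simp only [Nat.add_left_cancel_iff, ← Fin.ext_iff]
      have hE : (H ⊔ edge a b).Adj x y ↔ H.Adj x y ∨ (x = a ∧ y = b ∨ x = b ∧ y = a) := by
        rw [sup_adj, edge_adj, and_iff_left_of_imp]
        rintro (⟨rfl, rfl⟩ | ⟨rfl, rfl⟩)
        exacts [hne, hne.symm]
      by_cases hxb : x = b ∧ y = a
      · obtain ⟨rfl, rfl⟩ := hxb
        rw [paint_of_adj hzero' (hE.2 (by simp))]
        simp
      · by_cases hxa : x = a ∧ y = b
        · obtain ⟨rfl, rfl⟩ := hxa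
          rw [paint_of_adj hzero (hE.2 (by simp))]
          simp [hne]
        · rw [paint_congr (H' := H) (hE.trans (by tauto)), ← hx]
          by_cases h1 : x = b <;> by_cases h2 : x = a <;> simp_all
  -- The edge is present already, and adding it to `H` changes nothing.
  · rw [hcond, not_not] at hlt
    have hv := view_of_mem_eq (n := I.n) hm
    rw [sup_edge_of_adj _ hlt]
    exact ⟨h.congr hreg fun r _ => by rw [hv], fun r _ => by rw [hv]⟩

/-- Keep one more edge of `reg 12`, to `reg 13`, if there are not enough. -/
def keepStep : Cmd :=
  lookup 2 12 13 ;; ite 23 17 (ite 14 6 (addEdge 12 13 ;; add 14 14 2) skip) skip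

/-- Every vertex keeps `reg 6` of its edges, or all if there are fewer. -/
def keepEdges : Cmd := loop 12 (const 14 0 ;; loop 13 keepStep)

theorem ncard_edgeSet_sup_edge_le {V : Type*} [Finite V] (H : SimpleGraph V) (a b : V) :
    (H ⊔ edge a b).edgeSet.ncard ≤ H.edgeSet.ncard + 1 := by
  have : (H ⊔ edge a b).edgeSet ⊆ insert s(a, b) H.edgeSet := by
    intro e he
    induction e with
    | h x y =>
      rw [mem_edgeSet, sup_adj, edge_adj] at he
      rw [Set.mem_insert_iff, mem_edgeSet, Sym2.eq_iff]
      tauto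
  exact (Set.ncard_le_ncard this (Set.toFinite _)).trans (Set.ncard_insert_le _ _)

theorem keepStep_spec (h : Painted I R H s) {a b : Fin I.n} (ha : s.reg 12 = a)
    (hb : s.reg 13 = b) :
    ((I.graph.Adj a b ∧ s.reg 14 < s.reg 6) ∧ Painted I R (H ⊔ edge a b) (run I.n keepStep s) ∧
      (run I.n keepStep s).reg 14 = s.reg 14 + 1) ∨
    (¬ (I.graph.Adj a b ∧ s.reg 14 < s.reg 6) ∧ Painted I R H (run I.n keepStep s) ∧
      (run I.n keepStep s).reg 14 = s.reg 14) := by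
  obtain ⟨hm, h17⟩ := run_lookup I.n (B := 2) (x := 12) (y := 13) (by omega) s
  have hreg : ∀ x, modifies x (lookup 2 12 13) = false →
    (run I.n (lookup 2 12 13) s).reg x = s.reg x := fun x hx => run_reg_of_not_modifies _ _ hx s
  have hv := view_of_mem_eq (n := I.n) hm
  have hP : Painted I R H (run I.n (lookup 2 12 13) s) :=
    h.congr_run (by decide) fun r _ => by rw [hv]
  rw [ha, hb, h.layout.reg_two] at h17
  have hadj : 0 < s.mem (I.n * (1 + a) + b) ↔ I.graph.Adj a b := h.layout.adj a b
  simp only [keepStep, run]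
  rw [h17, hreg 23 (by decide), hreg 14 (by decide), hreg 6 (by decide), h.layout.reg_23]
  by_cases h1 : I.graph.Adj a b
  · by_cases h2 : s.reg 14 < s.reg 6
    · rw [if_pos (hadj.2 h1), if_pos h2]
      have := addEdge_spec hP (Or.inl ⟨rfl, rfl⟩) ((hreg 12 (by decide)).trans ha)
        ((hreg 13 (by decide)).trans hb) h1
      refine Or.inl ⟨⟨h1, h2⟩, this.1.set (by decide), ?_⟩
      rw [set_reg_self, run_reg_of_not_modifies _ _ (by decide), hreg 14 (by decide),
        run_reg_of_not_modifies _ _ (by decide), hP.layout.reg_two]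
    · rw [if_pos (hadj.2 h1), if_neg h2]
      refine Or.inr ⟨fun h => h2 h.2, hP.set (by decide), ?_⟩
      simp [skip, run, set_reg, hreg 14 (by decide)]
  · rw [if_neg (mt hadj.1 h1)]
    refine Or.inr ⟨fun h => h1 h.1, hP.set (by decide), ?_⟩
    simp [skip, run, set_reg, hreg 14 (by decide)]

/-- The counter in register 14 also counts edges that `H` had before. It thus bounds the number of
new edges from above and the degree from below; if it stays below its limit, no neighbour was
refused. -/
theorem keepEdges_vertex_spec (h : Painted I R H s) {a : Fin I.n} (ha : s.reg 12 = a) :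
    ∃ H', Painted I R H' (run I.n (const 14 0 ;; loop 13 keepStep) s) ∧ H ≤ H' ∧
      H'.edgeSet.ncard ≤ H.edgeSet.ncard + s.reg 6 ∧ KeepsDegree I.graph (s.reg 6) H' a := by
  have key : ∃ H', Painted I R H' (run I.n (const 14 0 ;; loop 13 keepStep) s) ∧ H ≤ H' ∧
      ∃ c ≤ s.reg 6, (run I.n (const 14 0 ;; loop 13 keepStep) s).reg 14 = c ∧
      H'.edgeSet.ncard ≤ H.edgeSet.ncard + c ∧
      c ≤ {y : Fin I.n | (y : ℕ) < I.n ∧ H'.Adj a y}.ncard ∧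
      (c < s.reg 6 → ∀ y : Fin I.n, (y : ℕ) < I.n → I.graph.Adj a y → H'.Adj a y) := by
    refine run_loop (s := s.set 14 0) (fun j s' => ∃ H', Painted I R H' s' ∧ H ≤ H' ∧
      ∃ c ≤ s.reg 6, s'.reg 14 = c ∧ H'.edgeSet.ncard ≤ H.edgeSet.ncard + c ∧
      c ≤ {y : Fin I.n | (y : ℕ) < j ∧ H'.Adj a y}.ncard ∧
      (c < s.reg 6 → ∀ y : Fin I.n, (y : ℕ) < j → I.graph.Adj a y → H'.Adj a y)) ?_ ?_
    · refine ⟨H, (h.set (by decide)).set (by decide), le_rfl, 0, Nat.zero_le _, ?_, ?_, ?_, ?_⟩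
      · simp [set_reg]
      · simp
      · simp
      · simp
    · rintro j s' hj h13 hs' ⟨H', hP, hle, c, hc, h14, hcard, hdeg, hall⟩
      have h12 : s'.reg 12 = a := by rw [hs' 12 (by decide), set_reg]; simpa using ha
      have h6 : s'.reg 6 = s.reg 6 := by rw [hs' 6 (by decide), set_reg]; simp
      rcases keepStep_spec hP h12 (b := ⟨j, hj⟩) h13 with ⟨⟨hadj, hlt⟩, hP', hc'⟩ | ⟨hn, hP', hc'⟩
      · rw [h14, h6] at hlt
        refine ⟨_, hP'.set (by decide), hle.trans le_sup_left, c + 1, hlt, ?_, ?_, ?_, ?_⟩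
        · simp [set_reg, hc', h14]
        · exact (ncard_edgeSet_sup_edge_le ..).trans (by omega)
        · refine (Nat.add_le_add_right hdeg 1).trans ?_
          rw [← Set.ncard_insert_of_notMem (a := (⟨j, hj⟩ : Fin I.n)) (by simp)]
          refine Set.ncard_le_ncard ?_ (Set.toFinite _)
          rintro y (rfl | hy)
          · exact ⟨Nat.lt_succ_self j, Or.inr ((edge_adj _ _ _ _).2 ⟨by simp, hadj.ne⟩)⟩
          · exact ⟨Nat.lt_succ_of_lt hy.1, Or.inl hy.2⟩
        · intro _ y hy hay
          rcases Nat.lt_succ_iff_lt_or_eq.1 hy with hy | hy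
          · exact Or.inl (hall (by omega) y hy hay)
          · obtain rfl : y = ⟨j, hj⟩ := Fin.ext hy
            exact Or.inr ((edge_adj _ _ _ _).2 ⟨by simp, hadj.ne⟩)
      · refine ⟨H', hP'.set (by decide), hle, c, hc, ?_, hcard, ?_, ?_⟩
        · simp [set_reg, hc', h14]
        · refine hdeg.trans (Set.ncard_le_ncard (fun y hy => ⟨?_, hy.2⟩) (Set.toFinite _))
          exact Nat.lt_succ_of_lt hy.1
        · intro hlt y hy hay
          rcases Nat.lt_succ_iff_lt_or_eq.1 hy with hy | hy
          · exact hall hlt y hy hay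
          · obtain rfl : y = ⟨j, hj⟩ := Fin.ext hy
            exact absurd ⟨hay, by rw [h14, h6]; exact hlt⟩ hn
  obtain ⟨H', hP, hle, c, hc, -, hcard, hdeg, hall⟩ := key
  refine ⟨H', hP, hle, by omega, ?_⟩
  rcases hc.lt_or_eq with hlt | rfl
  · exact Or.inl fun y hy => hall hlt y y.2 hy
  · exact Or.inr (by simpa using hdeg)

theorem keepEdges_spec (h : Painted I R H s) :
    ∃ H', Painted I R H' (run I.n keepEdges s) ∧ H ≤ H' ∧
      H'.edgeSet.ncard ≤ H.edgeSet.ncard + I.n * s.reg 6 ∧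
      ∀ x, KeepsDegree I.graph (s.reg 6) H' x := by
  have key : ∃ H', Painted I R H' (run I.n keepEdges s) ∧ H ≤ H' ∧
      H'.edgeSet.ncard ≤ H.edgeSet.ncard + I.n * s.reg 6 ∧
      ∀ x : Fin I.n, (x : ℕ) < I.n → KeepsDegree I.graph (s.reg 6) H' x := by
    refine run_loop (fun j s' => ∃ H', Painted I R H' s' ∧ H ≤ H' ∧
      H'.edgeSet.ncard ≤ H.edgeSet.ncard + j * s.reg 6 ∧
      ∀ x : Fin I.n, (x : ℕ) < j → KeepsDegree I.graph (s.reg 6) H' x) ?_ ?_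
    · exact ⟨H, h.set (by decide), le_rfl, by simp, by simp⟩
    · rintro j s' hj h12 hs' ⟨H', hP, hle, hcard, hdeg⟩
      have h6 : s'.reg 6 = s.reg 6 := hs' 6 (by decide)
      obtain ⟨H'', hP', hle', hcard', hdeg'⟩ := keepEdges_vertex_spec hP (a := ⟨j, hj⟩) h12
      rw [h6] at hcard' hdeg'
      refine ⟨H'', hP'.set (by decide), hle.trans hle', ?_, fun x hx => ?_⟩
      · rw [Nat.add_mul]; omega
      · rcases Nat.lt_succ_iff_lt_or_eq.1 hx with hx | hx
        · exact (hdeg x hx).mono hle'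
        · obtain rfl : x = ⟨j, hj⟩ := Fin.ext hx
          exact hdeg'
  obtain ⟨H', h1, h2, h3, h4⟩ := key
  exact ⟨H', h1, h2, h3, fun x => h4 x x.2⟩

end RAM.Cmd

/-! ### Adding shortest paths between terminals. -/

namespace RAM.Cmd

open MultiPriority SimpleGraph

variable {I : Instance} {R : Fin I.n → Fin I.n → ℕ} {H : SimpleGraph (Fin I.n)} {s s' : State}

/-- If `reg 13` precedes `reg 15` on a shortest path, add the edge and move to `reg 13`. -/
def backStep : Cmd :=
  lookup 2 13 15 ;; ite 23 17
    (get 17 21 13 ;; get 18 21 15 ;; ite 17 18 (addEdge 13 15 ;; add 15 13 23) skip) skip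

/-- Add a shortest path to `reg 10`, given the distances in row `2 * n + 1`. -/
def addPath : Cmd := add 15 10 23 ;; loop 12 (loop 13 backStep)

theorem backStep_spec (h : Painted I R H s) {x y : Fin I.n} (hx : s.reg 13 = x)
    (hy : s.reg 15 = y) {D : Fin I.n → ℕ} (hD : view I.n s (2 * I.n + 1) = D) :
    (I.graph.Adj x y ∧ D x < D y ∧ Painted I R (H ⊔ edge x y) (run I.n backStep s) ∧
      (run I.n backStep s).reg 15 = x ∧
      ∀ r, 2 * I.n < r → view I.n (run I.n backStep s) r = view I.n s r) ∨
    (¬ (I.graph.Adj x y ∧ D x < D y) ∧ Painted I R H (run I.n backStep s) ∧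
      (run I.n backStep s).reg 15 = y ∧
      ∀ r, 2 * I.n < r → view I.n (run I.n backStep s) r = view I.n s r) := by
  obtain ⟨hm, h17⟩ := run_lookup I.n (B := 2) (x := 13) (y := 15) (by omega) s
  have hreg : ∀ x, modifies x (lookup 2 13 15) = false →
    (run I.n (lookup 2 13 15) s).reg x = s.reg x := fun x hx => run_reg_of_not_modifies _ _ hx s
  have hv := view_of_mem_eq (n := I.n) hm
  have hP : Painted I R H (run I.n (lookup 2 13 15) s) :=
    h.congr_run (by decide) fun r _ => by rw [hv]
  rw [hx, hy, h.layout.reg_two] at h17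
  have hadj : 0 < s.mem (I.n * (1 + x) + y) ↔ I.graph.Adj x y := h.layout.adj x y
  have hskip : ∀ s₁ : State, run I.n skip s₁ = s₁.set 19 0 := fun _ => rfl
  simp only [backStep, run, hskip]
  rw [h17, hreg 23 (by decide), h.layout.reg_23]
  by_cases h1 : I.graph.Adj x y
  · rw [if_pos (hadj.2 h1)]
    set s₁ := run I.n (lookup 2 13 15) s with hs₁
    set s₂ := run I.n (get 18 21 15) (run I.n (get 17 21 13) s₁) with hs₂
    have hm₂ : s₂.mem = s.mem := by
      rw [hs₂, run_get _ (by omega) (by omega), run_get _ (by omega) (by omega)]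
      exact hm
    have hreg₂ : ∀ x ∈ [2, 7, 20, 21, 22, 23, 13, 15], s₂.reg x = s.reg x := by
      intro x hx
      rw [hs₂, run_reg_of_not_modifies _ _ ((by decide : ∀ x ∈ [2, 7, 20, 21, 22, 23, 13, 15],
        modifies x (get 18 21 15) = false) x hx),
        run_reg_of_not_modifies _ _ ((by decide : ∀ x ∈ [2, 7, 20, 21, 22, 23, 13, 15],
        modifies x (get 17 21 13) = false) x hx), hreg x ((by decide :
        ∀ x ∈ [2, 7, 20, 21, 22, 23, 13, 15], modifies x (lookup 2 13 15) = false) x hx)]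
    have e17 : s₂.reg 17 = D x := by
      rw [hs₂, run_reg_of_not_modifies _ _ (by decide), run_get _ (by omega) (by omega),
        set_reg_self, hm, hreg 21 (by decide), hreg 13 (by decide), h.layout.reg_21, hx, ← hD]
      rfl
    have e18 : s₂.reg 18 = D y := by
      rw [hs₂, run_get _ (by omega) (by omega), set_reg_self,
        run_get _ (by omega) (by omega), set_mem, set_mem, set_mem, hm, set_reg, set_reg, set_reg,
        set_reg, set_reg, set_reg]
      simp only [Nat.reduceEqDiff, if_false]
      rw [hreg 21 (by decide), hreg 15 (by decide), h.layout.reg_21, hy, ← hD]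
      rfl
    have hv₂ := view_of_mem_eq (n := I.n) hm₂
    have hP₂ : Painted I R H s₂ := h.congr (fun x hx => hreg₂ x (by simp at hx ⊢; tauto))
      fun r _ => by rw [hv₂]
    rw [e17, e18]
    by_cases h2 : D x < D y
    · rw [if_pos h2]
      have := addEdge_spec hP₂ (Or.inr ⟨rfl, rfl⟩) ((hreg₂ 13 (by simp)).trans hx)
        ((hreg₂ 15 (by simp)).trans hy) h1
      refine Or.inl ⟨h1, h2, this.1.set (by decide), ?_, fun r hr => ?_⟩
      · rw [set_reg_self, run_reg_of_not_modifies _ (addEdge 13 15) (by decide) s₂,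
          run_reg_of_not_modifies _ (addEdge 13 15) (by decide) s₂, hP₂.layout.reg_23,
          hreg₂ 13 (by simp), hx, Nat.add_zero]
      · rw [view_set, this.2 r hr, hv₂]
    · rw [if_neg h2]
      refine Or.inr ⟨fun h => h2 h.2, hP₂.set (by decide), ?_, fun r hr => by rw [view_set, hv₂]⟩
      rw [set_reg, if_neg (by decide), hreg₂ 15 (by simp), hy]
  · rw [if_neg (mt hadj.1 h1)]
    refine Or.inr ⟨fun h => h1 h.1, hP.set (by decide), ?_, fun r hr => by rw [view_set, hv]⟩
    rw [set_reg, if_neg (by decide), hreg 15 (by decide), hy]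

theorem addWalk_cons {V : Type*} {G H : SimpleGraph V} {x y v : V} (h : G.Adj x y)
    (p : G.Walk y v) : H.addWalk (Walk.cons h p) = H.addWalk p ⊔ edge x y := by
  ext a b
  simp only [addWalk, sup_adj, fromEdgeSet_adj, edge_adj, Walk.edges_cons, List.mem_cons,
    Set.mem_ofPred_eq, Sym2.eq_iff]
  tauto

/-- Distances of neighbours differ by at most 1. This is why the test D x < D y suffices to
recognise a step of a shortest path. -/
theorem IsDistances.adj_lt {n m : ℕ} {G : SimpleGraph (Fin n)} {u x y : Fin n} {D : Fin n → ℕ}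
    (hD : G.IsDistances u m D) (hm : n ≤ m) (hadj : G.Adj x y) (hy : D y < n) (hxy : D x < D y) :
    D x + 1 = D y := by
  rcases hD x with ⟨hx, -⟩ | ⟨-, hx⟩
  · rcases hD y with ⟨hy', -⟩ | ⟨-, hy'⟩
    · have h1 := (G.edist_triangle (u := u) (v := x) (w := y)).trans
        (add_le_add le_rfl (edist_eq_one_iff_adj.2 hadj).le)
      rw [hx, hy'] at h1
      norm_cast at h1
      omega
    · omega
  · omega

theorem IsDistances.exists_adj_lt {n m : ℕ} {G : SimpleGraph (Fin n)} {u y : Fin n}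
    {D : Fin n → ℕ} (hD : G.IsDistances u m D) (hm : n ≤ m) (hy : D y < n) (h0 : D y ≠ 0) :
    ∃ x, G.Adj x y ∧ D x < D y := by
  have hy' := ((hD y).resolve_right fun h => by omega).1
  rw [edist_comm] at hy'
  obtain ⟨p, hp⟩ := exists_walk_of_edist_eq_coe hy'
  cases p with
  | nil => simp at hp; omega
  | @cons _ x _ hadj q =>
    rw [Walk.length_cons] at hp
    refine ⟨x, hadj.symm, ?_⟩
    have hq := edist_le q
    rw [edist_comm] at hq
    rcases hD x with ⟨hx, -⟩ | ⟨hx, -⟩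
    · rw [hx] at hq
      norm_cast at hq
      omega
    · simp [hx] at hq

/-- The part of the path from `reg 15` to `v` has been added. -/
def PathAdded (I : Instance) (R : Fin I.n → Fin I.n → ℕ) (H : SimpleGraph (Fin I.n))
    (D : Fin I.n → ℕ) (v : Fin I.n) (s' : State)
    (C : (y : Fin I.n) → I.graph.Walk y v → Prop) : Prop :=
  ∃ (y : Fin I.n) (p : I.graph.Walk y v), s'.reg 15 = y ∧ D y + p.length = D v ∧
    Painted I R (H.addWalk p) s' ∧ C y p

/-- The path is traced back from `v`, and D y + |p| = D v holds throughout. Each outer pass makes at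
least one step unless D y = 0; it may make several, as the scan continues from the new vertex. -/
theorem addPath_spec (h : Painted I R H s) {u v : Fin I.n} (hv : s.reg 10 = v)
    (hD : I.graph.IsDistances u (2 * I.n + 2) (view I.n s (2 * I.n + 1)))
    (hfin : view I.n s (2 * I.n + 1) v < I.n) :
    ∃ p : I.graph.Walk u v, (p.length : ℕ∞) = I.graph.edist u v ∧
      Painted I R (H.addWalk p) (run I.n addPath s) := by
  set D := view I.n s (2 * I.n + 1) with hDdef
  have key : view I.n (run I.n addPath s) (2 * I.n + 1) = D ∧
      PathAdded I R H D v (run I.n addPath s) fun y p => D y = 0 ∨ I.n ≤ p.length := by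
    refine run_loop (s := s.set 15 (s.reg 10 + s.reg 23)) (fun i s' =>
      view I.n s' (2 * I.n + 1) = D ∧
      PathAdded I R H D v s' fun y p => D y = 0 ∨ i ≤ p.length) ?_ ?_
    · refine ⟨rfl, v, .nil, ?_, by simp, ?_, by simp⟩
      · simp [set_reg, h.layout.reg_23, hv]
      · have : H.addWalk (Walk.nil : I.graph.Walk v v) = H := by simp [addWalk]
        rw [this]
        exact (h.set (by decide)).set (by decide)
    · rintro i s₁ hi - hs₁ ⟨hD₁, hP₁⟩
      have key' : view I.n (run I.n (loop 13 backStep) s₁) (2 * I.n + 1) = D ∧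
          PathAdded I R H D v (run I.n (loop 13 backStep) s₁) fun y p => D y = 0 ∨ i < p.length ∨
            (i ≤ p.length ∧ ∀ x : Fin I.n, (x : ℕ) < I.n → ¬ (I.graph.Adj x y ∧ D x < D y)) := by
        refine run_loop (fun j s' => view I.n s' (2 * I.n + 1) = D ∧
          PathAdded I R H D v s' fun y p => D y = 0 ∨ i < p.length ∨
            (i ≤ p.length ∧ ∀ x : Fin I.n, (x : ℕ) < j → ¬ (I.graph.Adj x y ∧ D x < D y))) ?_ ?_
        · obtain ⟨y, p, h1, h2, h3, h4⟩ := hP₁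
          refine ⟨hD₁, y, p, by rw [set_reg]; exact h1, h2, h3.set (by decide), ?_⟩
          exact h4.imp_right fun h => Or.inr ⟨h, by simp⟩
        · rintro j s₂ hj h13 hs₂ ⟨hD₂, y, p, h15, hlen, hP₂, hprog⟩
          rcases backStep_spec hP₂ (x := ⟨j, hj⟩) h13 h15 hD₂ with
            ⟨hadj, hlt, hP₃, h15', hrow⟩ | ⟨hn, hP₃, h15', hrow⟩
          · have hsucc := IsDistances.adj_lt hD (by omega) hadj (by omega) hlt
            refine ⟨by rw [view_set, hrow _ (by omega), hD₂], ⟨j, hj⟩, .cons hadj p, ?_, ?_, ?_, ?_⟩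
            · rw [set_reg, if_neg (by decide), h15']
            · rw [Walk.length_cons]; omega
            · rw [addWalk_cons]; exact hP₃.set (by decide)
            · beta_reduce
              rw [Walk.length_cons]
              refine Or.inr (Or.inl ?_)
              rcases hprog with h | h | h <;> omega
          · refine ⟨by rw [view_set, hrow _ (by omega), hD₂], y, p, ?_, hlen,
              hP₃.set (by decide), ?_⟩
            · rw [set_reg, if_neg (by decide), h15']
            · refine hprog.imp_right (Or.imp_right fun h => ⟨h.1, fun x hx => ?_⟩)
              rcases Nat.lt_succ_iff_lt_or_eq.1 hx with hx | hx
              · exact h.2 x hx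
              · obtain rfl : x = ⟨j, hj⟩ := Fin.ext hx
                exact hn
      obtain ⟨hD₂, y, p, h1, h2, h3, h4⟩ := key'
      refine ⟨hD₂, y, p, by rw [set_reg]; exact h1, h2, h3.set (by decide), ?_⟩
      rcases h4 with h4 | h4 | ⟨-, h4⟩
      · exact Or.inl h4
      · exact Or.inr h4
      -- A full scan without a step contradicts the existence of a predecessor at smaller distance.
      · by_contra! h0
        obtain ⟨x, hx⟩ := IsDistances.exists_adj_lt hD (by omega) (by omega) h0.1
        exact h4 x x.2 hx
  obtain ⟨-, y, p, -, h2, h3, h4⟩ := key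
  -- The alternative n ≤ |p| is excluded by |p| ≤ D v < n.
  have hy0 : D y = 0 := by omega
  have huy : u = y := by
    rw [← edist_eq_zero_iff (G := I.graph)]
    rcases hD y with ⟨h, -⟩ | ⟨-, h⟩
    · rw [h, hy0]; rfl
    · omega
  subst huy
  refine ⟨p, ?_, h3⟩
  rcases hD v with ⟨h, -⟩ | ⟨-, h⟩
  · rw [h]; congr 1; omega
  · omega

/-- Add a shortest path from `reg 9` to `reg 10` if these are terminals at too large distance. -/
def pairStep : Cmd :=
  get 17 23 9 ;; ite 8 17
    (get 17 23 10 ;; ite 8 17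
      (bellmanFord 2 21 ;; bellmanFord 20 22 ;; get 17 21 10 ;; add 17 17 2 ;; add 17 17 2 ;;
        get 18 22 10 ;; ite 17 18 addPath skip)
      skip)
    skip

/-- Treat all pairs of terminals. -/
def addPaths : Cmd := loop 9 (loop 10 pairStep)

/-- With 2n + 2 for infinity the numerical test is exact: a finite distance plus 2 is below n + 2,
hence below infinity, while an infinite distance in `G` never triggers it. -/
theorem addPathIfFar_spec (h : Painted I R H s) {u v : Fin I.n} (hu : s.reg 9 = u)
    (hv : s.reg 10 = v) :
    ∃ H', Painted I R H' (run I.n (bellmanFord 2 21 ;; bellmanFord 20 22 ;; get 17 21 10 ;;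
        add 17 17 2 ;; add 17 17 2 ;; get 18 22 10 ;; ite 17 18 addPath skip) s) ∧
      (H' = H ∧ H.edist u v ≤ I.graph.edist u v + 2 ∨
        ∃ p : I.graph.Walk u v, H' = H.addWalk p ∧ (p.length : ℕ∞) = I.graph.edist u v ∧
          I.graph.edist u v + 2 < H.edist u v) := by
  have hL := h.layout
  obtain ⟨hr₁, hD₁⟩ := bellmanFord_spec (n := I.n) (B := 2) (d := 21) (Or.inl rfl) (Or.inl rfl)
    hL.reg_two hL.reg_23 (by rw [hL.reg_22]; omega) hu
    (fun x => by rw [hL.reg_two, hL.reg_21]; omega) (H := I.graph)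
    (by rw [hL.reg_two]; exact hL.adj)
  rw [hL.reg_21, hL.reg_22] at hD₁
  rw [hL.reg_21] at hr₁
  set s₁ := run I.n (bellmanFord 2 21) s with hs₁
  have hreg₁ : ∀ x, modifies x (bellmanFord 2 21) = false → s₁.reg x = s.reg x :=
    fun x hx => run_reg_of_not_modifies _ _ hx s
  have hP₁ : Painted I R H s₁ := h.congr_run (by decide) fun r hr => hr₁ r (by omega)
  have hL₁ := hP₁.layout
  obtain ⟨hr₂, hD₂⟩ := bellmanFord_spec (n := I.n) (s := s₁) (B := 20) (d := 22) (Or.inr rfl)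
    (Or.inr rfl) hL₁.reg_two hL₁.reg_23 (by rw [hL₁.reg_22]; omega)
    ((hreg₁ 9 (by decide)).trans hu)
    (fun x => by rw [hL₁.reg_20, hL₁.reg_22]; omega) (H := H)
    (by rw [hL₁.reg_20]; exact hP₁.pos_iff)
  rw [hL₁.reg_22] at hD₂ hr₂
  set s₂ := run I.n (bellmanFord 20 22) s₁ with hs₂
  have hreg₂ : ∀ x, modifies x (bellmanFord 20 22) = false → s₂.reg x = s₁.reg x :=
    fun x hx => run_reg_of_not_modifies _ _ hx s₁
  have hP₂ : Painted I R H s₂ := hP₁.congr_run (by decide) fun r hr => hr₂ r (by omega)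
  have hL₂ := hP₂.layout
  rw [← hr₂ _ (by omega)] at hD₁
  have h10 : s₂.reg 10 = v :=
    (hreg₂ 10 (by decide)).trans ((hreg₁ 10 (by decide)).trans hv)
  set s₃ := run I.n (get 17 21 10 ;; add 17 17 2 ;; add 17 17 2 ;; get 18 22 10) s₂ with hs₃
  have hm₃ : s₃.mem = s₂.mem := by
    simp [hs₃, run, run_get]
  have hv₃ := view_of_mem_eq (n := I.n) hm₃
  have e17 : s₃.reg 17 = view I.n s₂ (2 * I.n + 1) v + 2 := by
    simp [hs₃, run, run_get, set_reg, h10, hL₂.reg_21, hL₂.reg_two, view]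
  have e18 : s₃.reg 18 = view I.n s₂ (2 * I.n + 2) v := by
    simp [hs₃, run, run_get, set_reg, h10, hL₂.reg_22, view]
  have hP₃ : Painted I R H s₃ := hP₂.congr_run (by decide) fun r _ => by rw [hv₃]
  have hrun : run I.n (bellmanFord 2 21 ;; bellmanFord 20 22 ;; get 17 21 10 ;;
      add 17 17 2 ;; add 17 17 2 ;; get 18 22 10 ;; ite 17 18 addPath skip) s =
      if s₃.reg 17 < s₃.reg 18 then run I.n addPath s₃ else run I.n skip s₃ := rfl
  rw [hrun, e17, e18]
  by_cases hlt : view I.n s₂ (2 * I.n + 1) v + 2 < view I.n s₂ (2 * I.n + 2) v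
  · rw [if_pos hlt]
    have hG : I.graph.edist u v = view I.n s₂ (2 * I.n + 1) v ∧
        view I.n s₂ (2 * I.n + 1) v < I.n := by
      refine (hD₁ v).resolve_right fun h => ?_
      rcases hD₂ v with h' | h' <;> omega
    obtain ⟨p, hp, hPp⟩ := addPath_spec hP₃ (u := u) (v := v)
      (by rw [hs₃, run_reg_of_not_modifies _ _ (by decide), h10]) (by rw [hv₃]; exact hD₁)
      (by rw [hv₃]; exact hG.2)
    refine ⟨_, hPp, Or.inr ⟨p, rfl, hp, ?_⟩⟩
    rw [hG.1]
    rcases hD₂ v with ⟨h', -⟩ | ⟨h', -⟩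
    · rw [h']; exact_mod_cast hlt
    · rw [h']; exact ENat.add_lt_top.2 ⟨ENat.natCast_lt_top _, by decide⟩
  · rw [if_neg hlt]
    refine ⟨H, hP₃.set (by decide), Or.inl ⟨rfl, ?_⟩⟩
    rcases hD₁ v with ⟨h1, h1'⟩ | ⟨h1, -⟩
    · rcases hD₂ v with ⟨h2, -⟩ | ⟨-, h2⟩
      · rw [h1, h2]; exact_mod_cast not_lt.1 hlt
      · omega
    · rw [h1]; simp

theorem pairStep_spec (h : Painted I R H s) {u v : Fin I.n} (hu : s.reg 9 = u)
    (hv : s.reg 10 = v) {d : ℕ} (hdeg : ∀ x, KeepsDegree I.graph d H x) {S : Finset (Fin I.n)}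
    (hS : ∀ x, x ∈ S ↔ s.reg 8 < I.priority x) :
    ∃ H', Painted I R H' (run I.n pairStep s) ∧ H ≤ H' ∧
      H'.edgeSet.ncard * d + 3 * totalDeficit I.graph H' S ≤
        H.edgeSet.ncard * d + 3 * totalDeficit I.graph H S ∧
      (u ∈ S → v ∈ S → H'.edist u v ≤ I.graph.edist u v + 2) := by
  have hget : ∀ (s₁ : State) (i : ℕ), (i = 9 ∨ i = 10) → Painted I R H s₁ → ∀ x : Fin I.n,
      s₁.reg i = x → (∀ y ∈ [8, 9, 10], (run I.n (get 17 23 i) s₁).reg y = s₁.reg y) ∧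
      (run I.n (get 17 23 i) s₁).reg 17 = I.priority x ∧
      Painted I R H (run I.n (get 17 23 i) s₁) := by
    intro s₁ i hi hP x hx
    have hm : (run I.n (get 17 23 i) s₁).mem = s₁.mem := by
      rw [run_get _ (by omega) (by omega)]; rfl
    have hv := view_of_mem_eq (n := I.n) hm
    refine ⟨?_, ?_, ?_⟩
    · intro y hy
      refine run_reg_of_not_modifies _ _ ?_ s₁
      rcases hi with rfl | rfl <;> revert y <;> decide
    · rw [run_get _ (by omega) (by omega), set_reg_self, hx, hP.layout.reg_23]
      exact hP.layout.priority x
    · refine hP.congr_run ?_ fun r _ => by rw [hv]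
      rcases hi with rfl | rfl <;> decide
  obtain ⟨hreg₁, h17₁, hP₁⟩ := hget s 9 (Or.inl rfl) h u hu
  set s₁ := run I.n (get 17 23 9) s with hs₁
  obtain ⟨hreg₂, h17₂, hP₂⟩ := hget s₁ 10 (Or.inr rfl) hP₁ v ((hreg₁ 10 (by simp)).trans hv)
  set s₂ := run I.n (get 17 23 10) s₁ with hs₂
  have hrun : run I.n pairStep s = if s₁.reg 8 < s₁.reg 17 then
      (if s₂.reg 8 < s₂.reg 17 then run I.n (bellmanFord 2 21 ;; bellmanFord 20 22 ;;
        get 17 21 10 ;; add 17 17 2 ;; add 17 17 2 ;; get 18 22 10 ;; ite 17 18 addPath skip) s₂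
      else run I.n skip s₂) else run I.n skip s₁ := rfl
  rw [hrun, h17₁, h17₂, hreg₂ 8 (by simp), hreg₁ 8 (by simp)]
  by_cases h1 : s.reg 8 < I.priority u
  · rw [if_pos h1]
    by_cases h2 : s.reg 8 < I.priority v
    · rw [if_pos h2]
      obtain ⟨H', hP', hcase⟩ := addPathIfFar_spec hP₂ (u := u) (v := v)
        (by rw [hreg₂ 9 (by simp), hreg₁ 9 (by simp), hu])
        (by rw [hreg₂ 10 (by simp), hreg₁ 10 (by simp), hv])
      refine ⟨H', hP', ?_⟩
      rcases hcase with ⟨rfl, hle⟩ | ⟨p, rfl, hp, hviol⟩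
      · exact ⟨le_rfl, le_rfl, fun _ _ => hle⟩
      · refine ⟨le_sup_left, addWalk_potential_le h.le hdeg ((hS u).2 h1) ((hS v).2 h2) hp hviol,
          fun _ _ => ?_⟩
        have := (edist_addWalk_le H p (le_refl _)).1
        rw [Walk.getVert_length, hp] at this
        exact this.trans le_self_add
    · rw [if_neg h2]
      exact ⟨H, hP₂.set (by decide), le_rfl, le_rfl, fun _ hv => absurd ((hS v).1 hv) h2⟩
  · rw [if_neg h1]
    exact ⟨H, hP₁.set (by decide), le_rfl, le_rfl, fun hu => absurd ((hS u).1 hu) h1⟩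

/-- One pass over the pairs is enough, because degrees and stretch bounds already achieved persist
as the graph grows. -/
theorem addPaths_spec (h : Painted I R H s) {d : ℕ} (hdeg : ∀ x, KeepsDegree I.graph d H x)
    {S : Finset (Fin I.n)} (hS : ∀ x, x ∈ S ↔ s.reg 8 < I.priority x) :
    ∃ H', Painted I R H' (run I.n addPaths s) ∧ H ≤ H' ∧
      H'.edgeSet.ncard * d + 3 * totalDeficit I.graph H' S ≤
        H.edgeSet.ncard * d + 3 * totalDeficit I.graph H S ∧
      ∀ u ∈ S, ∀ v ∈ S, H'.edist u v ≤ I.graph.edist u v + 2 := by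
  let Inv : (Fin I.n → Fin I.n → Prop) → State → Prop := fun done s' =>
    ∃ H', Painted I R H' s' ∧ H ≤ H' ∧
      H'.edgeSet.ncard * d + 3 * totalDeficit I.graph H' S ≤
        H.edgeSet.ncard * d + 3 * totalDeficit I.graph H S ∧
      ∀ u v, done u v → u ∈ S → v ∈ S → H'.edist u v ≤ I.graph.edist u v + 2
  suffices hI : Inv (fun u _ => (u : ℕ) < I.n) (run I.n addPaths s) by
    obtain ⟨H', h1, h2, h3, h4⟩ := hI
    exact ⟨H', h1, h2, h3, fun u hu v hv => h4 u v u.2 hu hv⟩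
  refine run_loop (fun a s' => Inv (fun u _ => (u : ℕ) < a) s')
    ⟨H, h.set (by decide), le_rfl, le_rfl, by simp⟩ ?_
  intro a s₁ ha h9 hs₁ hI₁
  have key : Inv (fun u v => (u : ℕ) < a ∨ u = ⟨a, ha⟩ ∧ (v : ℕ) < I.n)
      (run I.n (loop 10 pairStep) s₁) := by
    refine run_loop (fun b s' => Inv (fun u v => (u : ℕ) < a ∨ u = ⟨a, ha⟩ ∧ (v : ℕ) < b) s') ?_ ?_
    · obtain ⟨H', h1, h2, h3, h4⟩ := hI₁
      exact ⟨H', h1.set (by decide), h2, h3, fun u v huv => h4 u v (by simpa using huv)⟩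
    · rintro b s₂ hb h10 hs₂ ⟨H', h1, h2, h3, h4⟩
      have h8 : s₂.reg 8 = s.reg 8 := (hs₂ 8 (by decide)).trans (hs₁ 8 (by decide))
      obtain ⟨H'', g1, g2, g3, g4⟩ := pairStep_spec h1 (u := ⟨a, ha⟩) (v := ⟨b, hb⟩)
        ((hs₂ 9 (by decide)).trans h9) h10 (fun x => (hdeg x).mono h2) (S := S)
        (by rw [h8]; exact hS)
      refine ⟨H'', g1.set (by decide), h2.trans g2, g3.trans h3, fun u v huv hu hv => ?_⟩
      rcases huv with huv | ⟨rfl, hvb⟩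
      · exact (edist_anti g2).trans (h4 u v (Or.inl huv) hu hv)
      · rcases Nat.lt_succ_iff_lt_or_eq.1 hvb with hvb | hvb
        · exact (edist_anti g2).trans (h4 _ v (Or.inr ⟨rfl, hvb⟩) hu hv)
        · obtain rfl : v = ⟨b, hb⟩ := Fin.ext hvb
          exact g4 hu hv
  obtain ⟨H', h1, h2, h3, h4⟩ := key
  refine ⟨H', h1.set (by decide), h2, h3, fun u v hu => h4 u v ?_⟩
  rcases Nat.lt_succ_iff_lt_or_eq.1 hu with hu | hu
  exacts [Or.inl hu, Or.inr ⟨Fin.ext hu, v.2⟩]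

end RAM.Cmd

/-! ### Thresholds and the rounds. -/

namespace RAM.Cmd

open MultiPriority SimpleGraph

variable {I : Instance} {R : Fin I.n → Fin I.n → ℕ} {H : SimpleGraph (Fin I.n)} {s s' : State}

/-- Count in `reg 14` the vertices of priority at least `reg 15`. -/
def countStep : Cmd := get 17 23 13 ;; ite 17 15 skip (add 14 14 2)

/-- Let `reg x` be at least the priority of `reg 12`, if at least `reg 5` vertices have at least
this priority. -/
def thresholdStep (x : ℕ) : Cmd :=
  const 14 0 ;; get 15 23 12 ;; loop 13 countStep ;;
    ite 14 5 skip (ite x 15 (add x 15 23) skip)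

/-- Let `reg x` be the largest level with at least `reg 5` terminals. -/
def threshold (x : ℕ) : Cmd := const x 0 ;; loop 12 (thresholdStep x)

theorem card_filter_lt_succ {n j : ℕ} (hj : j < n) (p : Fin n → Prop) [DecidablePred p] :
    (Finset.univ.filter fun w : Fin n => (w : ℕ) < j + 1 ∧ p w).card =
      (Finset.univ.filter fun w : Fin n => (w : ℕ) < j ∧ p w).card +
        if p ⟨j, hj⟩ then 1 else 0 := by
  have hiff : ∀ w : Fin n, (w : ℕ) < j + 1 ↔ (w : ℕ) < j ∨ w = ⟨j, hj⟩ := fun w => by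
    rw [Nat.lt_succ_iff_lt_or_eq, Fin.ext_iff]
  split_ifs with h
  · rw [← Finset.card_insert_of_notMem (a := (⟨j, hj⟩ : Fin n)) (by simp)]
    congr 1
    ext w
    simp only [hiff, Finset.mem_filter, Finset.mem_univ, true_and, Finset.mem_insert]
    constructor
    · rintro ⟨h1 | rfl, h2⟩
      exacts [Or.inr ⟨h1, h2⟩, Or.inl rfl]
    · rintro (rfl | h1)
      exacts [⟨Or.inr rfl, h⟩, ⟨Or.inl h1.1, h1.2⟩]
  · have : (Finset.univ.filter fun w : Fin n => (w : ℕ) < j + 1 ∧ p w) =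
        Finset.univ.filter fun w : Fin n => (w : ℕ) < j ∧ p w := by
      refine Finset.filter_congr fun w _ => ?_
      rw [hiff]
      constructor
      · rintro ⟨h1 | rfl, h2⟩
        exacts [⟨h1, h2⟩, absurd h2 h]
      · exact fun h1 => ⟨Or.inl h1.1, h1.2⟩
    rw [this, Nat.add_zero]

theorem Layout.set (h : Layout I s) {x v : ℕ} (hx : x ∉ [2, 20, 21, 22, 23]) :
    Layout I (s.set x v) :=
  h.congr (fun y hy => by rw [set_reg, if_neg]; rintro rfl; exact hx hy) fun _ _ => rfl

theorem Layout.congr_run (h : Layout I s) {c : Cmd}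
    (hc : ∀ x ∈ [2, 20, 21, 22, 23], modifies x c = false)
    (hmem : (run I.n c s).mem = s.mem) : Layout I (run I.n c s) :=
  h.congr (fun x hx => run_reg_of_not_modifies _ _ (hc x hx) s)
    fun _ _ => by rw [view_of_mem_eq hmem]

theorem countStep_spec (h : Layout I s) {w : Fin I.n} (hw : s.reg 13 = w) :
    (run I.n countStep s).mem = s.mem ∧ (run I.n countStep s).reg 14 =
      s.reg 14 + if s.reg 15 ≤ I.priority w then 1 else 0 := by
  have hp : s.mem (I.n * 0 + w) = I.priority w := h.priority w
  simp only [countStep, run]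
  rw [run_get _ (by omega) (by omega)]
  simp only [set_reg, h.reg_23, hw, hp]
  by_cases hlt : (I.priority w : ℕ) < s.reg 15
  · simp [hlt, not_le.2 hlt, skip, run, set_reg]
  · simp [hlt, not_lt.1 hlt, h.reg_two]

theorem thresholdStep_spec {x : ℕ} (hx : x = 7 ∨ x = 8) (h : Layout I s) {v : Fin I.n}
    (hv : s.reg 12 = v) :
    (run I.n (thresholdStep x) s).mem = s.mem ∧ (run I.n (thresholdStep x) s).reg x =
      if s.reg 5 ≤ (I.terminals (I.priority v)).card ∧ s.reg x < I.priority v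
        then (I.priority v : ℕ) else s.reg x := by
  set s₁ := run I.n (const 14 0 ;; get 15 23 12) s with hs₁
  have hm₁ : s₁.mem = s.mem := by simp [hs₁, run, run_get]
  have hL₁ : Layout I s₁ := h.congr_run (by decide) hm₁
  have h14 : s₁.reg 14 = 0 := by simp [hs₁, run, run_get, set_reg]
  have h15 : s₁.reg 15 = I.priority v := by
    simpa [hs₁, run, run_get, set_reg, h.reg_23, hv, view] using h.priority v
  set s₂ := run I.n (loop 13 countStep) s₁ with hs₂
  have key : s₂.mem = s.mem ∧ s₂.reg 14 = (Finset.univ.filter fun w : Fin I.n =>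
      (w : ℕ) < I.n ∧ (I.priority v : ℕ) ≤ I.priority w).card := by
    refine run_loop (fun j s' => s'.mem = s.mem ∧ s'.reg 14 = (Finset.univ.filter fun w : Fin I.n =>
      (w : ℕ) < j ∧ (I.priority v : ℕ) ≤ I.priority w).card) ?_ ?_
    · simp [set_reg, hm₁, h14]
    · rintro j s' hj h13 hs' ⟨hm, hc⟩
      have hL : Layout I s' := hL₁.congr
        (fun y hy => hs' y ((by decide : ∀ y ∈ [2, 20, 21, 22, 23],
          modifies y (loop 13 countStep) = false) y hy))
        fun _ _ => by rw [view_of_mem_eq (hm.trans hm₁.symm)]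
      have := countStep_spec hL (w := ⟨j, hj⟩) h13
      refine ⟨this.1.trans hm, ?_⟩
      rw [set_reg, if_neg (by decide), this.2, hc, card_filter_lt_succ hj, hs' 15 (by decide), h15]
  have hcard : s₂.reg 14 = (I.terminals (I.priority v)).card := by
    rw [key.2, Instance.terminals]
    congr 1
    ext w
    simp
  have hreg₂ : ∀ y ∈ [5, 7, 8, 23], s₂.reg y = s.reg y := fun y hy => by
    rw [hs₂, run_reg_of_not_modifies _ _ ((by decide : ∀ y ∈ [5, 7, 8, 23],
        modifies y (loop 13 countStep) = false) y hy), hs₁,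
      run_reg_of_not_modifies _ _ ((by decide : ∀ y ∈ [5, 7, 8, 23],
        modifies y (const 14 0 ;; get 15 23 12) = false) y hy)]
  have h15' : s₂.reg 15 = I.priority v := by
    rw [hs₂, run_reg_of_not_modifies _ _ (by decide), h15]
  have hrun : run I.n (thresholdStep x) s = if s₂.reg 14 < s₂.reg 5 then run I.n skip s₂ else
      if s₂.reg x < s₂.reg 15 then s₂.set x (s₂.reg 15 + s₂.reg 23) else run I.n skip s₂ := rfl
  have hx2 : s₂.reg x = s.reg x := hreg₂ x (by rcases hx with rfl | rfl <;> simp)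
  have hx19 : x ≠ 19 := by omega
  rw [hrun, hcard, hreg₂ 5 (by simp), h15', hreg₂ 23 (by simp), h.reg_23, hx2]
  by_cases h1 : (I.terminals (I.priority v)).card < s.reg 5
  · simp [h1, not_le.2 h1, skip, run, set_reg, hx19, hx2, key.1]
  · by_cases h2 : s.reg x < I.priority v
    · simp [h1, not_lt.1 h1, h2, key.1]
    · simp [h1, h2, skip, run, set_reg, hx19, hx2, key.1]

/-- Only the priorities of vertices are tried as levels, since a search through all k levels would
not be polynomial in log k. -/
theorem threshold_spec {x : ℕ} (hx : x = 7 ∨ x = 8) (h : Layout I s) (h5 : 0 < s.reg 5) :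
    (run I.n (threshold x) s).mem = s.mem ∧
      I.IsThreshold (s.reg 5) ((run I.n (threshold x) s).reg x) := by
  have key : (run I.n (threshold x) s).mem = s.mem ∧ ∀ i, 1 ≤ i →
      (i ≤ (run I.n (threshold x) s).reg x ↔ ∃ v : Fin I.n, (v : ℕ) < I.n ∧
        s.reg 5 ≤ (I.terminals (I.priority v)).card ∧ i ≤ I.priority v) := by
    have hx' : x ≠ 12 ∧ x ≠ 5 := by omega
    refine run_loop (s := s.set x 0) (fun j s' => s'.mem = s.mem ∧ ∀ i, 1 ≤ i →
      (i ≤ s'.reg x ↔ ∃ v : Fin I.n, (v : ℕ) < j ∧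
        s.reg 5 ≤ (I.terminals (I.priority v)).card ∧ i ≤ I.priority v)) ?_ ?_
    · simp [set_reg, hx'.1]
      omega
    · rintro j s' hj h12 hs' ⟨hm, ih⟩
      have hreg : ∀ y ∈ [2, 20, 21, 22, 23, 5], s'.reg y = s.reg y := fun y hy => by
        rw [hs' y (by rcases hx with rfl | rfl <;> revert y <;> decide), set_reg, if_neg]
        rintro rfl
        simp at hy
        omega
      have hL : Layout I s' := h.congr (fun y hy => hreg y (by simp at hy ⊢; tauto))
        fun _ _ => by rw [view_of_mem_eq hm]
      obtain ⟨hm', hr⟩ := thresholdStep_spec hx hL (v := ⟨j, hj⟩) h12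
      refine ⟨hm'.trans hm, fun i hi => ?_⟩
      rw [set_reg, if_neg hx'.1, hr, hreg 5 (by simp)]
      have hex : (∃ v : Fin I.n, (v : ℕ) < j + 1 ∧
          s.reg 5 ≤ (I.terminals (I.priority v)).card ∧ i ≤ I.priority v) ↔
          i ≤ s'.reg x ∨ (s.reg 5 ≤ (I.terminals (I.priority ⟨j, hj⟩)).card ∧
            i ≤ I.priority ⟨j, hj⟩) := by
        rw [ih i hi]
        constructor
        · rintro ⟨v, hvj, hv⟩
          rcases Nat.lt_succ_iff_lt_or_eq.1 hvj with hvj | hvj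
          · exact Or.inl ⟨v, hvj, hv⟩
          · obtain rfl : v = ⟨j, hj⟩ := Fin.ext hvj
            exact Or.inr hv
        · rintro (⟨v, hvj, hv⟩ | hv)
          exacts [⟨v, Nat.lt_succ_of_lt hvj, hv⟩, ⟨⟨j, hj⟩, Nat.lt_succ_self j, hv⟩]
      rw [hex]
      split_ifs with hc
      · constructor
        · exact fun h => Or.inr ⟨hc.1, h⟩
        · rintro (h | h)
          exacts [by omega, h.2]
      · constructor
        · exact Or.inl
        · rintro (h | h)
          · exact h
          · by_contra hlt
            exact hc ⟨h.1, by omega⟩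
  refine ⟨key.1, fun i hi => ?_⟩
  rw [key.2 i hi]
  constructor
  · rintro ⟨v, -, hv, hiv⟩
    refine hv.trans (Finset.card_le_card fun w hw => ?_)
    simp only [Instance.terminals, Finset.mem_filter] at hw ⊢
    exact ⟨hw.1, hiv.trans hw.2⟩
  · intro hcard
    -- A vertex of least priority in T_i defines the same terminal set, so no level is overlooked.
    obtain ⟨v, hv, hmin⟩ := Finset.exists_min_image (I.terminals i)
      (fun v => (I.priority v : ℕ)) (Finset.card_pos.1 (h5.trans_le hcard))
    refine ⟨v, v.2, hcard.trans (Finset.card_le_card fun w hw => ?_), (Finset.mem_filter.1 hv).2⟩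
    exact Finset.mem_filter.2 ⟨Finset.mem_univ _, hmin w hw⟩

/-- The `j`-th round, which takes care of the levels with at least `4 ^ j` and less than
`4 ^ (j + 1)` terminals. -/
def round : Cmd :=
  threshold 7 ;; add 5 5 5 ;; add 5 5 5 ;; threshold 8 ;;
    ite 23 7 (keepEdges ;; addPaths) skip ;; add 6 6 6

/-- The state before round `j`. -/
structure RoundState (I : Instance) (j : ℕ) (s : State) : Prop where
  layout : Layout I s
  reg_5 : s.reg 5 = 4 ^ j
  reg_6 : s.reg 6 = 2 ^ j
  invariant : I.RoundInvariant j fun x y => view I.n s (I.n + 1 + x) y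

theorem RoundState.set {j : ℕ} (h : RoundState I j s) {x v : ℕ}
    (hx : x ∉ [2, 5, 6, 20, 21, 22, 23]) : RoundState I j (s.set x v) where
  layout := h.layout.set (by simp at hx ⊢; tauto)
  reg_5 := by rw [set_reg, if_neg (by rintro rfl; simp at hx), h.reg_5]
  reg_6 := by rw [set_reg, if_neg (by rintro rfl; simp at hx), h.reg_6]
  invariant := h.invariant

/-- Register 5 is quadrupled between the two threshold computations, so registers 7 and 8 hold the
thresholds for 4 ^ j and 4 ^ (j + 1). The terminals of the round are T_(q+1), with q in register 8.
-/
theorem round_spec {j : ℕ} (h : RoundState I j s) : RoundState I (j + 1) (run I.n round s) := by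
  obtain ⟨hm₁, ht₁⟩ := threshold_spec (Or.inl rfl) h.layout (by rw [h.reg_5]; positivity)
  set s₁ := run I.n (threshold 7) s with hs₁
  have hreg₁ : ∀ x, modifies x (threshold 7) = false → s₁.reg x = s.reg x :=
    fun x hx => run_reg_of_not_modifies _ _ hx s
  have hL₁ : Layout I s₁ := h.layout.congr_run (by decide) hm₁
  have e5₁ : s₁.reg 5 = 4 ^ j := (hreg₁ 5 (by decide)).trans h.reg_5
  set s₂ := run I.n (add 5 5 5 ;; add 5 5 5) s₁ with hs₂
  have hreg₂ : ∀ x, modifies x (add 5 5 5) = false → s₂.reg x = s₁.reg x :=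
    fun x hx => run_reg_of_not_modifies _ (add 5 5 5 ;; add 5 5 5)
      (by simpa [modifies] using hx) s₁
  have hL₂ : Layout I s₂ := hL₁.congr_run (by decide) rfl
  have e5₂ : s₂.reg 5 = 4 ^ (j + 1) := by
    simp only [hs₂, run, set_reg_self, e5₁, pow_succ]; ring
  obtain ⟨hm₃, ht₃⟩ := threshold_spec (Or.inr rfl) hL₂ (by rw [e5₂]; positivity)
  set s₃ := run I.n (threshold 8) s₂ with hs₃
  have hreg₃ : ∀ x, modifies x (threshold 8) = false → s₃.reg x = s₂.reg x :=
    fun x hx => run_reg_of_not_modifies _ _ hx s₂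
  have hL₃ : Layout I s₃ := hL₂.congr_run (by decide) hm₃
  have e5₃ : s₃.reg 5 = 4 ^ (j + 1) := (hreg₃ 5 (by decide)).trans e5₂
  have e6₃ : s₃.reg 6 = 2 ^ j :=
    (hreg₃ 6 (by decide)).trans ((hreg₂ 6 (by decide)).trans ((hreg₁ 6 (by decide)).trans h.reg_6))
  have e7₃ : s₃.reg 7 = s₁.reg 7 := (hreg₃ 7 (by decide)).trans (hreg₂ 7 (by decide))
  rw [h.reg_5, ← e7₃] at ht₁
  rw [e5₂] at ht₃
  have hv₃ : view I.n s₃ = view I.n s := view_of_mem_eq (hm₃.trans hm₁)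
  have hinv := h.invariant
  rw [← hv₃] at hinv
  have hrun : run I.n round s = run I.n (add 6 6 6) (if s₃.reg 23 < s₃.reg 7 then
    run I.n (keepEdges ;; addPaths) s₃ else run I.n skip s₃) := rfl
  rw [hrun, hL₃.reg_23]
  by_cases h7 : 0 < s₃.reg 7
  · rw [if_pos h7]
    set R : Fin I.n → Fin I.n → ℕ := fun x y => view I.n s₃ (I.n + 1 + x) y with hR
    -- The round starts from the graph of all positive rates, where painting changes nothing.
    have hP₃ : Painted I R (levelGraph R 1) s₃ :=
      ⟨hL₃, hinv.matrix, h7, le_rfl, hinv.matrix.levelGraph_le le_rfl,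
        fun x y => by rw [hinv.matrix.paint_self]⟩
    obtain ⟨H₄, hP₄, hle₄, hcard₄, hdeg₄⟩ := keepEdges_spec hP₃
    set s₄ := run I.n keepEdges s₃ with hs₄
    have e8₄ : s₄.reg 8 = s₃.reg 8 := run_reg_of_not_modifies _ _ (by decide) _
    have hS : ∀ x, x ∈ I.terminals (s₃.reg 8 + 1) ↔ s₄.reg 8 < I.priority x := by
      intro x
      rw [e8₄]
      simp [Instance.terminals]
    obtain ⟨H₅, hP₅, hle₅, hpot, hspan⟩ := addPaths_spec hP₄ hdeg₄ hS
    have hreg₅ : ∀ x, modifies x (keepEdges ;; addPaths) = false →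
        (run I.n (keepEdges ;; addPaths) s₃).reg x = s₃.reg x :=
      fun x hx => run_reg_of_not_modifies _ _ hx s₃
    -- By maximality of q, the set T_(q+1) has fewer than 4 ^ (j + 1) elements.
    have hScard : (I.terminals (s₃.reg 8 + 1)).card ≤ 4 * (2 ^ j) ^ 2 := by
      have h1 := (ht₃ (s₃.reg 8 + 1) (by omega)).not.1 (by omega)
      rw [← pow_mul, mul_comm j 2, pow_mul]
      rw [pow_succ] at h1
      norm_num at h1 ⊢
      omega
    rw [e6₃] at hpot hcard₄
    have hcard₅ := ncard_le_of_potential_le hScard (by positivity) hpot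
    -- The constant 37 is 1 for the kept edges plus 36 for the paths.
    have hfin := hinv.succ ht₁ ht₃ hP₅.le (hle₄.trans hle₅) (by
        have : 37 * I.n * 2 ^ j = I.n * 2 ^ j + 36 * I.n * 2 ^ j := by ring
        omega) fun u v hu hv => hspan u ((hS u).2 (by rw [e8₄]; exact hu)) v
          ((hS v).2 (by rw [e8₄]; exact hv))
    refine ⟨hP₅.layout.set (by decide), ?_, ?_, ?_⟩
    · exact (set_reg ..).trans ((hreg₅ 5 (by decide)).trans e5₃)
    · refine (set_reg_self ..).trans ?_
      rw [hreg₅ 6 (by decide), e6₃, pow_succ]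
      ring
    · have e7 : (run I.n addPaths s₄).reg 7 = s₃.reg 7 := hreg₅ 7 (by decide)
      have : (fun x y : Fin I.n => view I.n (run I.n addPaths s₄) (I.n + 1 + x) y) =
          paint R (s₃.reg 7) H₅ := by
        funext x y
        rw [hP₅.view_eq, e7]
      rw [← this] at hfin
      exact hfin
  · rw [if_neg h7]
    have h0 : s₃.reg 7 = 0 := by omega
    rw [h0] at ht₁
    refine ⟨(hL₃.set (by decide)).set (by decide), ?_, ?_, hinv.succ_of_threshold_zero ht₁⟩
    · exact (set_reg ..).trans ((set_reg ..).trans e5₃)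
    · refine (set_reg_self ..).trans ?_
      simp [skip, run, set_reg, e6₃, pow_succ]
      ring

/-! ### Input, output and the complete program. -/

/-- Copy the rates to the first rows. -/
def copyRates : Cmd := loop 12 (loop 13 (lookup 20 12 13 ;; put 12 13 17))

/-- Writing stays in rows below n and reading in rows from n + 1 on, so no rate is lost; the
overwritten input is no longer needed. -/
theorem copyRates_spec (h20 : s.reg 20 = I.n + 1) (x y : Fin I.n) :
    view I.n (run I.n copyRates s) x y = view I.n s (I.n + 1 + x) y := by
  let Inv : (Fin I.n → Fin I.n → Prop) → State → Prop := fun done s' =>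
    (∀ x : Fin I.n, view I.n s' (I.n + 1 + x) = view I.n s (I.n + 1 + x)) ∧
      ∀ x y : Fin I.n, done x y → view I.n s' x y = view I.n s (I.n + 1 + x) y
  suffices hI : Inv (fun x _ => (x : ℕ) < I.n) (run I.n copyRates s) from hI.2 x y x.2
  refine run_loop (fun a s' => Inv (fun x _ => (x : ℕ) < a) s')
    ⟨fun _ => rfl, fun x y hx => absurd hx (Nat.not_lt_zero _)⟩ ?_
  intro a s₁ ha h12 hs₁ hI₁
  have key : Inv (fun x y => (x : ℕ) < a ∨ x = ⟨a, ha⟩ ∧ (y : ℕ) < I.n)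
      (run I.n (loop 13 (lookup 20 12 13 ;; put 12 13 17)) s₁) := by
    refine run_loop (fun b s' => Inv (fun x y => (x : ℕ) < a ∨ x = ⟨a, ha⟩ ∧ (y : ℕ) < b) s')
      ⟨hI₁.1, fun x y hxy => hI₁.2 x y (by simpa using hxy)⟩ ?_
    intro b s₂ hb h13 hs₂ hI₂
    have hm : (run I.n (lookup 20 12 13 ;; put 12 13 17) s₂).mem =
        Function.update s₂.mem (I.n * s₂.reg 12 + s₂.reg 13)
          (s₂.mem (I.n * (s₂.reg 20 + s₂.reg 12) + s₂.reg 13)) := by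
      simp [lookup, run, run_get, run_put, set_reg]
    rw [h13, (hs₂ 12 (by decide)).trans h12, hs₂ 20 (by decide), hs₁ 20 (by decide), h20] at hm
    have hv := view_of_mem_eq_update (c0 := (⟨b, hb⟩ : Fin I.n)) hm
    have hval : s₂.mem (I.n * (I.n + 1 + a) + b) = view I.n s (I.n + 1 + a) ⟨b, hb⟩ := by
      rw [← hI₂.1 ⟨a, ha⟩]; rfl
    refine ⟨fun x => ?_, fun x y hxy => ?_⟩
    · rw [view_set, hv, if_neg (by omega), hI₂.1]
    · rw [view_set, hv, hval]
      by_cases hxa : (x : ℕ) = a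
      · obtain rfl : x = ⟨a, ha⟩ := Fin.ext hxa
        rw [if_pos rfl, Function.update_apply]
        split_ifs with hyb
        · rw [hyb]
        · refine hI₂.2 _ y (Or.inr ⟨rfl, ?_⟩)
          have hyb' : (y : ℕ) ≠ b := fun h => hyb (Fin.ext h)
          rcases hxy with h | h
          · exact absurd h (lt_irrefl a)
          · omega
      · rw [if_neg hxa]
        refine hI₂.2 x y (hxy.imp_right fun h => absurd (congrArg Fin.val h.1) hxa)
  refine ⟨key.1, fun x y hx => key.2 x y ?_⟩
  rcases Nat.lt_succ_iff_lt_or_eq.1 hx with hx | hx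
  exacts [Or.inl hx, Or.inr ⟨Fin.ext hx, y.2⟩]

/-- Set up the constants. -/
def prelude : Cmd :=
  add 20 0 2 ;; add 21 20 0 ;; add 22 21 2 ;; const 23 0 ;; const 5 1 ;; const 6 1

/-- The algorithm. -/
def spanner : Cmd := prelude ;; loop 11 round ;; copyRates

theorem encode_row_zero (I : Instance) (reg : ℕ → ℕ) (v : Fin I.n) :
    view I.n ⟨reg, I.encode.mem⟩ 0 v = I.priority v := by
  simp [view, Instance.encode]

theorem encode_row_succ (I : Instance) (reg : ℕ → ℕ) (u v : Fin I.n) :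
    0 < view I.n ⟨reg, I.encode.mem⟩ (1 + u) v ↔ I.graph.Adj u v := by
  have e : I.n * (1 + u) + v = I.n + (I.n * u + v) := by ring
  have hn : 0 < I.n := by have := u.2; omega
  have hlt : I.n * u + v < I.n * I.n := by
    calc I.n * u + v < I.n * u + I.n := by have := v.2; omega
      _ = I.n * (u + 1) := by ring
      _ ≤ I.n * I.n := Nat.mul_le_mul_left _ u.2
  simp only [view, Instance.encode, e]
  rw [dif_neg (by omega), dif_pos (by rw [Nat.add_sub_cancel_left]; exact hlt)]
  have h1 : Fin.divNat (⟨I.n + (I.n * u + v) - I.n, by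
      rw [Nat.add_sub_cancel_left]; exact hlt⟩ : Fin (I.n * I.n)) = u := by
    ext
    simp [Fin.divNat, Nat.mul_add_div hn, Nat.div_eq_of_lt v.2]
  have h2 : Fin.modNat (⟨I.n + (I.n * u + v) - I.n, by
      rw [Nat.add_sub_cancel_left]; exact hlt⟩ : Fin (I.n * I.n)) = v := by
    ext
    simp [Fin.modNat, Nat.mod_eq_of_lt v.2]
  rw [h1, h2]
  split_ifs with h <;> simp [h]

theorem encode_row_rates (I : Instance) (reg : ℕ → ℕ) (x y : Fin I.n) :
    view I.n ⟨reg, I.encode.mem⟩ (I.n + 1 + x) y = 0 := by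
  have e : I.n * (I.n + 1 + x) + y = I.n + (I.n * I.n + (I.n * x + y)) := by ring
  simp only [view, Instance.encode, e]
  rw [dif_neg (by omega), dif_neg (by omega)]

theorem spanner_spec (I : Instance) :
    ∃ R, I.RoundInvariant I.n R ∧
      ∀ x y : Fin I.n, view I.n (run I.n spanner (I.encode.set 2 1)) x y = R x y := by
  have h0 : I.encode.reg 0 = I.n := rfl
  set s₀ := run I.n prelude (I.encode.set 2 1) with hs₀
  have hm₀ : s₀ = ⟨s₀.reg, I.encode.mem⟩ := rfl
  have hL : Layout I s₀ := by
    refine ⟨?_, ?_, ?_, ?_, ?_, fun v => ?_, fun u v => ?_⟩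
    · simp [hs₀, prelude, run, set_reg]
    · simp [hs₀, prelude, run, set_reg, h0]
    · simp [hs₀, prelude, run, set_reg, h0]; ring
    · simp [hs₀, prelude, run, set_reg, h0]; ring
    · simp [hs₀, prelude, run, set_reg]
    · rw [hm₀]; exact encode_row_zero I _ v
    · rw [hm₀]; exact encode_row_succ I _ u v
  have hR₀ : RoundState I 0 s₀ := by
    refine ⟨hL, ?_, ?_, ?_⟩
    · simp [hs₀, prelude, run, set_reg]
    · simp [hs₀, prelude, run, set_reg]
    · have : (fun x y => view I.n s₀ (I.n + 1 + (x : Fin I.n)) y) = fun _ _ => 0 := by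
        funext x y
        rw [hm₀]; exact encode_row_rates I _ x y
      rw [this]
      exact I.roundInvariant_zero
  have hR : RoundState I I.n (run I.n (loop 11 round) s₀) :=
    run_loop (fun j s' => RoundState I j s') (hR₀.set (by decide))
      fun j s' _ _ _ h => (round_spec h).set (by decide)
  exact ⟨_, hR.invariant, copyRates_spec hR.layout.reg_20⟩

end RAM.Cmd

/-! ### Conclusion. -/

namespace MultiPriority

open RAM RAM.Cmd

theorem polyTimeComputable_spanner {β : ℕ} (hβ : 2 ≤ β) {f : ℕ → ℕ → ℝ}
    (hf : ∀ n t : ℕ, 74 * (n * (t : ℝ) ^ ((1 : ℝ) / 2)) ≤ f n t) :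
    PolyTimeComputable fun I H => I.IsAdditiveSpanner β H ∧ I.SizeBound f H := by
  -- Register 2 is set outside the compiled command, since well-formed commands may not write to it.
  refine ⟨.seq (.const 2 1) (compile spanner), cost spanner + 1, fun I => ?_⟩
  obtain ⟨R, hR, hout⟩ := spanner_spec I
  obtain ⟨t, ht, e⟩ := exec_compile I.n spanner (by decide) (I.encode.set 2 1)
    (by simp [set_reg, Instance.encode]) (by simp)
  refine ⟨_, _, hR.matrix.toRatedSubgraph, .seq (.const 2 1 I.encode) e, ?_, fun u v => ?_,
    hR.isAdditiveSpanner hβ, hR.sizeBound hf⟩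
  · rw [Polynomial.eval_add, Polynomial.eval_one]
    have : (cost spanner).eval I.n ≤ (cost spanner).eval I.size := by
      rw [Polynomial.eval_eq_sum_range, Polynomial.eval_eq_sum_range]
      gcongr
      exact Nat.le_add_right _ _
    omega
  · have := hout u v
    rw [view] at this
    rw [this]
    have hadj : hR.matrix.toRatedSubgraph.graph.Adj u v ↔ 1 ≤ R u v :=
      hR.matrix.levelGraph_adj le_rfl
    split_ifs with h
    · rfl
    · rw [hadj] at h; omega

theorem rpow_half_le {t : ℕ} {p : ℝ} (hp : 1 / 2 ≤ p) :
    (t : ℝ) ^ ((1 : ℝ) / 2) ≤ (t : ℝ) ^ p := by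
  rcases Nat.eq_zero_or_pos t with rfl | ht
  · rw [Nat.cast_zero, Real.zero_rpow (by norm_num), Real.zero_rpow (by linarith)]
  · exact Real.rpow_le_rpow_of_exponent_le (by exact_mod_cast ht) hp

end MultiPriority

theorem mainTheorem5 :
    (∃ C : ℝ, MultiPriority.PolyTimeComputable fun I H =>
      I.IsAdditiveSpanner 2 H ∧
      I.SizeBound (fun n t => C * ((n : ℝ) * (t : ℝ) ^ ((2 : ℝ) / 3))) H) ∧
    (∃ (C : ℝ) (c : ℕ), MultiPriority.PolyTimeComputable fun I H =>
      I.IsAdditiveSpanner 4 H ∧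
      I.SizeBound (fun n t => C * ((n : ℝ) * (t : ℝ) ^ ((4 : ℝ) / 7) * Real.log n ^ c)) H) ∧
    (∃ C : ℝ, MultiPriority.PolyTimeComputable fun I H =>
      I.IsAdditiveSpanner 6 H ∧
      I.SizeBound (fun n t => C * ((n : ℝ) * (t : ℝ) ^ ((1 : ℝ) / 2))) H) := by
  -- For stretch 4 the exponent of the logarithm is 0: no logarithmic factor is needed, and log n =
  -- 0 at n = 1 does no harm.
  refine ⟨⟨74, MultiPriority.polyTimeComputable_spanner le_rfl fun n t => ?_⟩,
    ⟨74, 0, MultiPriority.polyTimeComputable_spanner (by norm_num) fun n t => ?_⟩,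
    ⟨74, MultiPriority.polyTimeComputable_spanner (by norm_num) fun n t => le_rfl⟩⟩
  · gcongr 74 * (_ * ?_)
    exact MultiPriority.rpow_half_le (by norm_num)
  · rw [pow_zero, mul_one]
    gcongr 74 * (_ * ?_)
    exact MultiPriority.rpow_half_le (by norm_num)
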